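/- **Setting.** Fix integers $s\ge 1$, $k\ge 0$ and a number $\kappa>0$. For units $i=1,2,\dots$ let $c_i\ge 0$, $\boldsymbol\gamma_i\in\mathbb{R}^k_+$, $f_{\alpha,i}:\{0,1\}^s\to\mathbb{R}_+$ and $f_{\gamma,i}:[0,1]^{2s}\to\mathbb{R}_+$ be given; let also $f_\gamma:\mathbb{R}^{2s}_+\to\mathbb{R}^k_+$ and $\beta_1,\dots,\beta_s\in\mathbb{R}$ be given. For each (sufficiently large) $N$ consider, on its own probability space, random variables $p_{i,t}\in[0,1]$ and $u_{i,t}$, $1\le i\le N$, $t\ge 1-s$. Put $y_{i,t}=I(u_{i,t}\le p_{i,t})$. Suppose that for every $t\ge 1-s$ the errors $u_{1,t},\dots,u_{N,t}$ are i.i.d. uniform on $[0,1]$ and independent of the $\sigma$-field generated by the (possibly random) initial probabilities $\{p_{i,r}\}_{i\le N,\,1-s\le r\le 0}$ and the past outcomes $\{y_{i,r}\}_{i\le N,\,1-s\le r\le t-1}$, and that for every $t>0$ \[ \begin{split} p_{i,t}&=\frac{c_i}{N}+\frac1{N^{\kappa}}f_{\alpha,i}(y_{i,t-1},\ldots,y_{i,t-s})+\sum_{\tau=1}^{s}\beta_{\tau}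 p_{i,t-\tau}\\ &+f_{\gamma,i}\Big(\frac1{N}\sum_{j=1}^{N}y_{j,t-1},\ldots,\frac1{N}\sum_{j=1}^{N}y_{j,t-s}, \frac1{N}\sum_{j=1}^{N}p_{j,t-1},\ldots,\frac1{N}\sum_{j=1}^{N}p_{j,t-s}\Big)\\ &+\frac1{N}\boldsymbol\gamma_i^{\mathsf T}f_{\gamma}\Big(\sum_{j=1}^{N}y_{j,t-1},\ldots,\sum_{j=1}^{N}y_{j,t-s}, \sum_{j=1}^{N}p_{j,t-1},\ldots,\sum_{j=1}^{N}p_{j,t-s}\Big). \end{split} \] Let $X_t(N)=\sum_{i=1}^N y_{i,t}$. **Assumptions.** There are finite constants $C,A,M$ such that, for all $i$: $c_i\le C$ and $\|\boldsymbol\gamma_i\|\le C$; $|f_{\alpha,i}(v_1,\dots,v_s)|\le A\sum_{\tau=1}^s v_\tau$ on $\{0,1\}^s$; $f_{\gamma,i}$ is twice continuously differentiable on $[0,1]^{2s}$ with gradient and Hessian bounded by $M$, $f_{\gamma,i}(0)=0$ and $\nabla f_{\gamma,i}(0)\in\mathbb{R}^{2s}_+$. The function $f_\gamma$ is either continuous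 and bounded, or continuously differentiable with bounded Jacobian. The limits \[ \bar c=\lim_{N\to\infty}\frac1N\sum_{i=1}^N c_i,\qquad \bar{\boldsymbol\gamma}=\lim_{N\to\infty}\frac1N\sum_{i=1}^N\boldsymbol\gamma_i,\qquad \bar{\mathbf f}=\lim_{N\to\infty}\frac1N\sum_{i=1}^N\nabla f_{\gamma,i}(0) \] exist. There are integrable random variables $\lambda_0,\dots,\lambda_{1-s}$ on a common probability space such that, as $N\to\infty$, \[ \Big(\sum_{i=1}^N p_{i,\tau}\Big)_{\tau=0,\dots,1-s}\xrightarrow{d}(\lambda_\tau)_{\tau=0,\dots,1-s}\quad\text{jointly}, \] and, for each $\tau=0,\dots,1-s$, $\sum_{i=1}^N\mathbb{E}p_{i,\tau}\to\mathbb{E}\lambda_\tau$ and $\max_{i\le N}p_{i,\tau}\xrightarrow{p}0$. **Conclusion.** There are a probability space, integer-valued $X_t\ge0$ and real $\lambda_t$, $t\ge 1-s$, on it, such that $(\lambda_0,\dots,\lambda_{1-s})$ has the joint law given above and: 1. as $N\to\infty$, $[X_t(N)]_{t\ge 1-s}$ converges in finite-dimensional distributions to $[X_t]_{t\ge 1-s}$;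 2. for every $t\ge 1-s$, $\lambda_t\ge0$ almost surely and, conditionally on the $\sigma$-field $\mathcal I^X_{t-1}$ generated by $\{X_{t-1},\dots,X_{1-s},\lambda_0,\dots,\lambda_{1-s}\}$ (by $\lambda_0,\dots,\lambda_{1-s}$ alone if $t=1-s$), $X_t$ has the Poisson distribution with intensity $\lambda_t$; 3. $\lambda_t=\lim_{N\to\infty}\sum_{i=1}^N p_{i,t}$ in distribution, jointly with the limit in 1: the processes $[(X_t(N),\sum_{i=1}^N p_{i,t})]_{t\ge 1-s}$ converge in finite-dimensional distributions to $[(X_t,\lambda_t)]_{t\ge 1-s}$; 4. for every $t>0$, almost surely, \[ \lambda_t=\bar c+\sum_{\tau=1}^s\beta_\tau\lambda_{t-\tau}+(X_{t-1},\dots,X_{t-s},\lambda_{t-1},\dots,\lambda_{t-s})\,\bar{\mathbf f}+\bar{\boldsymbol\gamma}^{\mathsf T}f_\gamma(X_{t-1},\dots,X_{t-s},\lambda_{t-1},\dots,\lambda_{t-s}). \] -/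

import Mathlib

open MeasureTheory ProbabilityTheory Filter Topology

/-- A list of `s` lagged values of a first quantity followed by `s` lagged values of a second one:
an element of `ℝ^{2s}`. -/
abbrev LagSpace (s : ℕ) : Type := Fin s ⊕ Fin s → ℝ

/-- Coefficients and functions of the nonlinear interactive model with `s` lags. The units are
numbered `0, 1, 2, …`; the list of lags `τ = 1, …, s` is indexed by `τ - 1 : Fin s`. -/
structure GABCoeffs (s k : ℕ) where
  κ : ℝ
  c : ℕ → ℝ
  fα : ℕ → (Fin s → Fin 2) → ℝ
  β : Fin s → ℝ
  /-- only the values on the cube `[0,1]^{2s}` matter -/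
  fγi : ℕ → LagSpace s → ℝ
  γ : ℕ → Fin k → ℝ
  /-- only the values on the orthant `ℝ₊^{2s}` matter -/
  fγ : LagSpace s → Fin k → ℝ

/-- The cube `[0,1]^{2s}`. -/
def lagCube (s : ℕ) : Set (LagSpace s) := Set.Icc 0 1

/-- The orthant `ℝ₊^{2s}`. -/
def lagOrthant (s : ℕ) : Set (LagSpace s) := Set.Ici 0

/-- `(a_{t-1}, …, a_{t-s}, b_{t-1}, …, b_{t-s})`. -/
def lagVector (s : ℕ) (a b : ℤ → ℝ) (t : ℤ) : LagSpace s :=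
  Sum.elim (fun τ => a (t - 1 - (τ : ℤ))) (fun τ => b (t - 1 - (τ : ℤ)))

/-- The gradient at the origin of a function on the cube `[0,1]^{2s}` (the one-sided derivative;
the cube is a convex set with non-empty interior, so that it is unique). -/
noncomputable def gradAtZero {s : ℕ} (f : LagSpace s → ℝ) : LagSpace s :=
  fun j => fderivWithin ℝ f (lagCube s) 0 (Pi.single j 1)

section Path

variable {N : ℕ} {Ω : Type*}

/-- The outcome `y_{i,t} = I(u_{i,t} ≤ p_{i,t})`. -/
noncomputable def outcome (p u : ℤ → Fin N → Ω → ℝ) (t : ℤ) (i : Fin N) (ω : Ω) : Fin 2 :=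
  if u t i ω ≤ p t i ω then 1 else 0

/-- The number of successes `X_t(N) = y_{1,t} + ⋯ + y_{N,t}`, as a real number. -/
noncomputable def successCount (p u : ℤ → Fin N → Ω → ℝ) (t : ℤ) (ω : Ω) : ℝ :=
  ∑ i, ((outcome p u t i ω : ℕ) : ℝ)

/-- The sum of the success probabilities at time `t`. -/
noncomputable def probSum (p : ℤ → Fin N → Ω → ℝ) (t : ℤ) (ω : Ω) : ℝ :=
  ∑ i, p t i ω

/-- The right-hand side of the equation for `p_{i,t}`. -/
noncomputable def GABCoeffs.update {s k : ℕ} (θ : GABCoeffs s k) (p u : ℤ → Fin N → Ω → ℝ)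
    (t : ℤ) (i : Fin N) (ω : Ω) : ℝ :=
  θ.c i / N
    + 1 / (N : ℝ) ^ θ.κ * θ.fα i (fun τ => outcome p u (t - 1 - (τ : ℤ)) i ω)
    + ∑ τ : Fin s, θ.β τ * p (t - 1 - (τ : ℤ)) i ω
    + θ.fγi i (lagVector s (fun r => 1 / N * successCount p u r ω)
        (fun r => 1 / N * probSum p r ω) t)
    + 1 / N * (θ.γ i ⬝ᵥ θ.fγ (lagVector s (fun r => successCount p u r ω)
        (fun r => probSum p r ω) t))

/-- The information available before time `t`: the `σ`-field generated by the initial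
probabilities `p_{i,r}`, `1 - s ≤ r ≤ 0`, and the outcomes `y_{i,r}`, `1 - s ≤ r ≤ t - 1`. -/
@[reducible] noncomputable def pastInfo (s : ℕ) (p u : ℤ → Fin N → Ω → ℝ) (t : ℤ) : MeasurableSpace Ω :=
  (⨆ r ∈ Set.Icc (1 - (s : ℤ)) 0, ⨆ i, MeasurableSpace.comap (p r i) inferInstance) ⊔
    ⨆ r ∈ Set.Icc (1 - (s : ℤ)) (t - 1), ⨆ i, MeasurableSpace.comap (outcome p u r i) ⊤

/-- `p` and `u` are the success probabilities and the errors of a path `t ≥ 1 - s` of the nonlinear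
interactive model with `N` units: the errors at time `t` are, given the past, i.i.d. uniform on
`[0,1]`, and for `t > 0` the probabilities solve the model equation. -/
structure IsGABPath {s k : ℕ} (θ : GABCoeffs s k) [MeasurableSpace Ω] (P : Measure Ω)
    (p u : ℤ → Fin N → Ω → ℝ) : Prop where
  prob_mem : ∀ t, 1 - (s : ℤ) ≤ t → ∀ i ω, p t i ω ∈ Set.Icc (0 : ℝ) 1
  error_law : ∀ t, 1 - (s : ℤ) ≤ t → ∀ i, P.map (u t i) = volume.restrict (Set.Icc (0 : ℝ) 1)
  error_iIndep : ∀ t, 1 - (s : ℤ) ≤ t → iIndepFun (fun i => u t i) P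
  error_indep_past : ∀ t, 1 - (s : ℤ) ≤ t →
    Indep (MeasurableSpace.comap (fun ω i => u t i ω) MeasurableSpace.pi) (pastInfo s p u t) P
  evolution : ∀ t, 0 < t → ∀ i ω, p t i ω = θ.update p u t i ω

end Path

/-- Convergence in finite-dimensional distributions, as `N → ∞`, of processes with time
`t = t₀, t₀ + 1, …` (each process of the sequence lives on its own probability space). -/
def TendstoFDD {E : Type*} [TopologicalSpace E] [SecondCountableTopology E] [MeasurableSpace E]
    [BorelSpace E] {Ω : ℕ → Type*} [∀ N, MeasurableSpace (Ω N)] {Ω' : Type*} [MeasurableSpace Ω']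
    (t₀ : ℤ) (Y : ∀ N, ℤ → Ω N → E) (Z : ℤ → Ω' → E)
    (P : ∀ N, Measure (Ω N)) [∀ N, IsProbabilityMeasure (P N)]
    (Q : Measure Ω') [IsProbabilityMeasure Q] : Prop :=
  ∀ I : Finset ℤ, (∀ t ∈ I, t₀ ≤ t) →
    TendstoInDistribution (fun N ω (t : I) => Y N t ω) atTop (fun ω (t : I) => Z t ω) P Q

/-- The `σ`-field generated by `X_t, …, X_{1-s}` and `λ_0, …, λ_{1-s}`. -/
@[reducible] def limitInfo {Ω' : Type*} (s : ℕ) (X : ℤ → Ω' → ℕ) (lam : ℤ → Ω' → ℝ) (t : ℤ) :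
    MeasurableSpace Ω' :=
  (⨆ r ∈ Set.Icc (1 - (s : ℤ)) t, MeasurableSpace.comap (X r) ⊤) ⊔
    ⨆ r ∈ Set.Icc (1 - (s : ℤ)) 0, MeasurableSpace.comap (lam r) inferInstance

/-- Conditionally on the `σ`-field `m`, the variable `X` is Poisson with (random) intensity `lam`.
The intensity is required to be almost surely non-negative. -/
def IsCondPoisson {Ω' : Type*} [MeasurableSpace Ω'] (Q : Measure Ω') (X : Ω' → ℕ) (lam : Ω' → ℝ)
    (m : MeasurableSpace Ω') : Prop :=
  (∀ᵐ ω ∂Q, 0 ≤ lam ω) ∧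
    ∀ n : ℕ, Q[(X ⁻¹' {n}).indicator (fun _ => (1 : ℝ)) | m] =ᵐ[Q]
      fun ω => (poissonMeasure (lam ω).toNNReal).real {n}

/-! The argument is an induction over time that enlarges a jointly convergent finite vector by one
coordinate at a time: at each date first the sum of probabilities, then the success count. Three
facts carry it.

Poisson limit. Given the past, `p_{i,t}` is known and the errors are i.i.d. uniform, so with `w =
exp (ib)` the conditional characteristic function of the count is `∏ (1 + p_{i,t} (w - 1))`. It
differs from the Poisson one, `exp ((∑ p_{i,t}) (w - 1))`, by at most `8 ∑ p_{i,t}² ≤ 8 (max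
p_{i,t}) (∑ p_{i,t})`. This vanishes in probability once the maximum does and the sum is tight. The
error can then be dropped under the expectation because all factors are bounded
(`norm_prod_sub_exp_sum_le`, `TendstoOnCoords.insert_of_poisson`).

Recursion of the sums. Summing the model equation over units gives the limiting recursion up to a
vanishing deterministic rate times a continuous envelope of the lagged sums. The averages of the
coefficients converge; the `fα` terms add up to order `N^{-κ}` times lagged counts; and `N`
second-order Taylor remainders at the origin, each of order `N^{-2}`, leave order `1/N`. Since the
lags converge, the envelope is tight and the error is negligible (`IsGABPath.abs_probSum_sub_le`,
`TendstoOnCoords.insert_of_negligible`).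

Small probabilities. The maximum satisfies an autoregressive inequality with an error of the same
kind, so its smallness passes from the initial dates to all later ones (`IsGABPath.maxProb_le`,
`negligible_maxProb`).

The limit is built explicitly on a sequence space: an initial state with the prescribed law, fresh
uniform variables turned into Poisson counts by a measurable simulation, and the limiting recursion
for the intensity. Its conditional Poisson property comes from independence of the fresh noise, and
the nonnegativity of its intensities from that of the approximating sums. -/

/-- The positive parts of the `R N` tend to zero in probability. -/
def Negligible {Ω : ℕ → Type*} [∀ N, MeasurableSpace (Ω N)] (P : ∀ N, Measure (Ω N))
    (R : ∀ N, Ω N → ℝ) : Prop :=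
  Tendsto (fun N => ∫⁻ ω, min 1 (ENNReal.ofReal (R N ω)) ∂(P N)) atTop (𝓝 0)

/-- The `K N` are bounded above in probability. -/
def BddInProb {Ω : ℕ → Type*} [∀ N, MeasurableSpace (Ω N)] (P : ∀ N, Measure (Ω N))
    (K : ∀ N, Ω N → ℝ) : Prop :=
  ∀ ε : ENNReal, 0 < ε → ∃ δ : ℝ, 0 < δ ∧
    ∀ᶠ N in atTop, ∫⁻ ω, min 1 (ENNReal.ofReal (δ * K N ω)) ∂(P N) ≤ ε

/-! ### Calculus of negligible and tight sequences in probability. -/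

section Negligible

variable {Ω : ℕ → Type*} [∀ N, MeasurableSpace (Ω N)] {P : ∀ N, Measure (Ω N)}
  {R R' : ∀ N, Ω N → ℝ}

lemma Negligible.mono (h : Negligible P R') (hle : ∀ᶠ N in atTop, ∀ ω, R N ω ≤ R' N ω) :
    Negligible P R := by
  refine tendsto_of_tendsto_of_tendsto_of_le_of_le' tendsto_const_nhds h
    (.of_forall fun N => zero_le) ?_
  filter_upwards [hle] with N hN
  exact lintegral_mono fun ω => min_le_min_left _ (ENNReal.ofReal_le_ofReal (hN ω))

lemma min_one_add_le (a b : ENNReal) : min 1 (a + b) ≤ min 1 a + min 1 b := by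
  rcases le_total 1 a with ha | ha
  · simp [ha]
  rcases le_total 1 b with hb | hb
  · exact (min_le_left _ _).trans (by rw [min_eq_left hb]; exact le_add_self)
  · rw [min_eq_right ha, min_eq_right hb]; exact min_le_right _ _

lemma negligible_zero : Negligible P (fun _ _ => 0) := by
  simp [Negligible]

lemma Negligible.add (h : Negligible P R) (h' : Negligible P R')
    (hR : ∀ᶠ N in atTop, Measurable (R N)) :
    Negligible P (fun N ω => R N ω + R' N ω) := by
  have h2 := Tendsto.add h h'
  rw [add_zero] at h2
  refine tendsto_of_tendsto_of_tendsto_of_le_of_le' tendsto_const_nhds h2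
    (.of_forall fun N => zero_le) ?_
  filter_upwards [hR] with N hN
  rw [← lintegral_add_left (by fun_prop)]
  refine lintegral_mono fun ω => (min_le_min_left _ ENNReal.ofReal_add_le).trans
    (min_one_add_le _ _)

lemma Negligible.sum {ι : Type*} (s : Finset ι) {R : ι → ∀ N, Ω N → ℝ}
    (h : ∀ i ∈ s, Negligible P (R i)) (hR : ∀ i ∈ s, ∀ᶠ N in atTop, Measurable (R i N)) :
    Negligible P (fun N ω => ∑ i ∈ s, R i N ω) := by
  classical
  induction s using Finset.induction_on with
  | empty => simpa using negligible_zero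
  | insert a s ha ih =>
    simp only [Finset.sum_insert ha]
    exact (h a (by simp)).add (ih (fun i hi => h i (by simp [hi])) fun i hi => hR i (by simp [hi]))
      (hR a (by simp))

lemma min_one_ofReal_mul_le {c x : ℝ} (hc : 0 ≤ c) :
    min 1 (ENNReal.ofReal (c * x)) ≤ ENNReal.ofReal (max 1 c) * min 1 (ENNReal.ofReal x) := by
  -- Truncation at 1 is not homogeneous: for `c < 1` and large `x` the factor `c` alone would be too
  -- small, hence `max 1 c`.
  have h1 : (1 : ENNReal) ≤ ENNReal.ofReal (max 1 c) := by
    rw [← ENNReal.ofReal_one]; exact ENNReal.ofReal_le_ofReal (le_max_left _ _)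
  rcases le_total 1 (ENNReal.ofReal x) with hx | hx
  · rw [min_eq_left hx, mul_one]; exact (min_le_left _ _).trans h1
  · rw [min_eq_right hx, ENNReal.ofReal_mul hc]
    exact (min_le_right _ _).trans (mul_le_mul_left (ENNReal.ofReal_le_ofReal (le_max_right _ _)) _)

lemma Negligible.const_mul (h : Negligible P R) {c : ℝ} (hc : 0 ≤ c) :
    Negligible P (fun N ω => c * R N ω) := by
  have h2 := ENNReal.Tendsto.const_mul (a := ENNReal.ofReal (max 1 c)) h (.inr (by simp))
  rw [mul_zero] at h2
  refine tendsto_of_tendsto_of_tendsto_of_le_of_le tendsto_const_nhds h2 (fun N => zero_le) ?_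
  intro N
  simp only
  rw [← lintegral_const_mul' _ _ (by simp)]
  exact lintegral_mono fun ω => min_one_ofReal_mul_le hc

lemma BddInProb.mul_tendsto_zero (h : BddInProb P R) (hR : ∀ᶠ N in atTop, ∀ ω, 0 ≤ R N ω)
    {e : ℕ → ℝ} (he : Tendsto e atTop (𝓝 0)) : Negligible P (fun N ω => e N * R N ω) := by
  rw [Negligible, ENNReal.tendsto_nhds_zero]
  intro ε hε
  obtain ⟨δ, hδ, h⟩ := h ε hε
  filter_upwards [h, hR, he.eventually_le_const hδ] with N h hR he
  refine le_trans (lintegral_mono fun ω => min_le_min_left _ (ENNReal.ofReal_le_ofReal ?_)) h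
  exact mul_le_mul_of_nonneg_right he (hR ω)

lemma Negligible.mul_bddInProb (h : Negligible P R) (h' : BddInProb P R')
    (hR0 : ∀ᶠ N in atTop, ∀ ω, 0 ≤ R N ω)
    (hR : ∀ᶠ N in atTop, Measurable (R N)) : Negligible P (fun N ω => R N ω * R' N ω) := by
  rw [Negligible, ENNReal.tendsto_nhds_zero]
  intro ε hε
  obtain ⟨δ, hδ, h'⟩ := h' (ε / 2) (by simpa using hε.ne')
  have h1 := h.const_mul (inv_nonneg.2 hδ.le)
  rw [Negligible, ENNReal.tendsto_nhds_zero] at h1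
  filter_upwards [h', h1 (ε / 2) (by simpa using hε.ne'), hR, hR0] with N h' h1 hR hR0
  rw [← ENNReal.add_halves ε]
  refine le_trans ?_ (add_le_add h1 h')
  rw [← lintegral_add_left (by fun_prop)]
  refine lintegral_mono fun ω => ?_
  -- Where `δ R' ≤ 1` the product is at most `δ⁻¹ R`; elsewhere the truncated `δ R'` already equals
  -- 1.
  rcases le_total (δ * R' N ω) 1 with hle | hle
  · refine le_trans (min_le_min_left _ (ENNReal.ofReal_le_ofReal ?_)) le_self_add
    rw [mul_comm]
    refine mul_le_mul_of_nonneg_right ?_ (hR0 ω)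
    rw [← one_div, le_div_iff₀ hδ]; linarith
  · refine le_trans (min_le_left _ _) (le_trans ?_ le_add_self)
    simp [hle]

lemma negligible_of_tendsto_measure [∀ N, IsProbabilityMeasure (P N)]
    (h : ∀ ε : ℝ, 0 < ε → Tendsto (fun N => P N {ω | ε ≤ R N ω}) atTop (𝓝 0))
    (hR : ∀ N, Measurable (R N)) :
    Negligible P R := by
  rw [Negligible, ENNReal.tendsto_nhds_zero]
  intro ε hε
  obtain ⟨r, hr, hrε⟩ : ∃ r : ℝ, 0 < r ∧ ENNReal.ofReal r ≤ ε / 2 := by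
    rcases eq_or_ne ε ⊤ with rfl | hε'
    · exact ⟨1, one_pos, by simp [ENNReal.top_div]⟩
    · exact ⟨(ε / 2).toReal, ENNReal.toReal_pos (by simpa using hε.ne')
        (ENNReal.div_ne_top hε' (by simp)), ENNReal.ofReal_toReal_le⟩
  have h1 := h r hr
  rw [ENNReal.tendsto_nhds_zero] at h1
  filter_upwards [h1 (ε / 2) (by simpa using hε.ne')] with N h1
  rw [← ENNReal.add_halves ε]
  refine le_trans ?_ (add_le_add hrε h1)
  have hm : MeasurableSet {ω | r ≤ R N ω} := measurableSet_le measurable_const (hR N)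
  calc ∫⁻ ω, min 1 (ENNReal.ofReal (R N ω)) ∂(P N)
      ≤ ∫⁻ ω, ENNReal.ofReal r + ({ω | r ≤ R N ω}.indicator 1 ω) ∂(P N) := by
        refine lintegral_mono fun ω => ?_
        by_cases hω : r ≤ R N ω
        · refine (min_le_left _ _).trans (le_add_left ?_)
          simp [Set.indicator, hω]
        · exact (min_le_right _ _).trans (le_add_right (ENNReal.ofReal_le_ofReal (not_le.1 hω).le))
    _ = ENNReal.ofReal r + P N {ω | r ≤ R N ω} := by
        rw [lintegral_add_left (by fun_prop), lintegral_indicator_one hm]; simp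

/-- The difference of the integrands is at most both `2` and `R`, hence at most `2 min(1, R)`. This
turns pathwise errors that are small only in probability into errors between expectations. -/
lemma Negligible.tendsto_integral_sub (h : Negligible P R) {A B : ∀ N, Ω N → ℂ}
    (hA : ∀ᶠ N in atTop, Integrable (A N) (P N)) (hB : ∀ᶠ N in atTop, Integrable (B N) (P N))
    (hle : ∀ᶠ N in atTop, ∀ ω, ‖A N ω - B N ω‖ ≤ R N ω)
    (hle2 : ∀ᶠ N in atTop, ∀ ω, ‖A N ω - B N ω‖ ≤ 2) :
    Tendsto (fun N => ∫ ω, A N ω ∂(P N) - ∫ ω, B N ω ∂(P N)) atTop (𝓝 0) := by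
  rw [tendsto_zero_iff_enorm_tendsto_zero]
  have h2 := ENNReal.Tendsto.const_mul (a := 2) h (.inr (by simp))
  rw [mul_zero] at h2
  refine tendsto_of_tendsto_of_tendsto_of_le_of_le' tendsto_const_nhds h2
    (.of_forall fun N => zero_le) ?_
  filter_upwards [hA, hB, hle, hle2] with N hA hB hle hle2
  rw [← integral_sub hA hB, ← lintegral_const_mul' _ _ (by simp)]
  refine (enorm_integral_le_lintegral_enorm _).trans (lintegral_mono fun ω => ?_)
  rw [← ofReal_norm]
  rcases le_total 1 (ENNReal.ofReal (R N ω)) with hx | hx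
  · rw [min_eq_left hx]
    calc _ ≤ ENNReal.ofReal 2 := ENNReal.ofReal_le_ofReal (hle2 ω)
      _ = _ := by simp
  · rw [min_eq_right hx]
    refine (ENNReal.ofReal_le_ofReal (hle ω)).trans ?_
    rw [two_mul]; exact le_self_add

end Negligible

/-! ### Joint convergence in distribution of finitely many coordinates. -/

/-- Convergence in distribution of the finitely many coordinates in `J`. -/
def TendstoOnCoords {ι : Type*} {Ω : ℕ → Type*} [∀ N, MeasurableSpace (Ω N)] {Ω' : Type*}
    [MeasurableSpace Ω'] (J : Finset ι) (Y : ∀ N, Ω N → ι → ℝ) (Z : Ω' → ι → ℝ)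
    (P : ∀ N, Measure (Ω N)) [∀ N, IsProbabilityMeasure (P N)]
    (Q : Measure Ω') [IsProbabilityMeasure Q] : Prop :=
  TendstoInDistribution (fun N ω (i : J) => Y N ω i) atTop (fun ω (i : J) => Z ω i) P Q

open Classical in
/-- Extension by zero of a vector indexed by a finite set. -/
noncomputable def extendZero {ι : Type*} (J : Finset ι) (x : J → ℝ) (i : ι) : ℝ :=
  if h : i ∈ J then x ⟨i, h⟩ else 0

lemma continuous_extendZero {ι : Type*} (J : Finset ι) : Continuous (extendZero J) := by
  refine continuous_pi fun i => ?_
  by_cases h : i ∈ J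
  · simpa [extendZero, h] using continuous_apply _
  · simpa [extendZero, h] using continuous_const

/-- Lets a function on the full index set that only looks at `J` be treated as a function on `J →
ℝ`, so that index sets can grow without changing the test functions. -/
lemma DependsOn.extendZero_eq {ι E : Type*} {J : Finset ι} {φ : (ι → ℝ) → E}
    (hφ : DependsOn φ (J : Set ι)) (x : ι → ℝ) : φ (extendZero J fun i => x i) = φ x :=
  hφ fun i hi => by simp [extendZero, Finset.mem_coe.1 hi]

section TendstoOnCoords

variable {ι : Type*} {Ω : ℕ → Type*} [∀ N, MeasurableSpace (Ω N)] {Ω' : Type*}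
  [MeasurableSpace Ω'] {J : Finset ι} {Y : ∀ N, Ω N → ι → ℝ} {Z : Ω' → ι → ℝ}
  {P : ∀ N, Measure (Ω N)} [∀ N, IsProbabilityMeasure (P N)]
  {Q : Measure Ω'} [IsProbabilityMeasure Q]

lemma TendstoOnCoords.continuous_comp (h : TendstoOnCoords J Y Z P Q) {E : Type*}
    [TopologicalSpace E] [MeasurableSpace E] [BorelSpace E] {g : (ι → ℝ) → E} (hg : Continuous g)
    (hJ : DependsOn g (J : Set ι)) :
    TendstoInDistribution (fun N ω => g (Y N ω)) atTop (fun ω => g (Z ω)) P Q := by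
  have := TendstoInDistribution.continuous_comp (hg.comp (continuous_extendZero J)) h
  simpa [Function.comp_def, hJ.extendZero_eq] using this

lemma TendstoOnCoords.tendsto_integral (h : TendstoOnCoords J Y Z P Q) {φ : (ι → ℝ) → ℂ}
    (hφ : Continuous φ) (hJ : DependsOn φ (J : Set ι)) {c : ℝ} (hc : ∀ y, ‖φ y‖ ≤ c) :
    Tendsto (fun N => ∫ ω, φ (Y N ω) ∂(P N)) atTop (𝓝 (∫ ω, φ (Z ω) ∂Q)) := by
  have h1 := (ProbabilityMeasure.tendsto_iff_forall_integral_rclike_tendsto ℂ).1 h.tendsto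
  have hcont := hφ.comp (continuous_extendZero J)
  specialize h1 (BoundedContinuousFunction.ofNormedAddCommGroup (φ ∘ extendZero J) hcont c
    fun x => hc _)
  simp only [BoundedContinuousFunction.coe_ofNormedAddCommGroup, ProbabilityMeasure.coe_mk] at h1
  rw [integral_map h.aemeasurable_limit hcont.aestronglyMeasurable] at h1
  simp_rw [fun N => integral_map (h.forall_aemeasurable N) hcont.aestronglyMeasurable] at h1
  simpa [hJ.extendZero_eq] using h1

/-- Lévy's continuity theorem. -/
lemma tendstoOnCoords_of_charFun (hY : ∀ N, ∀ i ∈ J, Measurable fun ω => Y N ω i)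
    (hZ : ∀ i ∈ J, Measurable fun ω => Z ω i)
    (h : ∀ a : ι → ℝ, Tendsto
      (fun N => ∫ ω, Complex.exp ((∑ i ∈ J, a i * Y N ω i : ℝ) * Complex.I) ∂(P N)) atTop
      (𝓝 (∫ ω, Complex.exp ((∑ i ∈ J, a i * Z ω i : ℝ) * Complex.I) ∂Q))) :
    TendstoOnCoords J Y Z P Q := by
  have hY' : ∀ N, Measurable fun ω (i : J) => Y N ω i := fun N =>
    measurable_pi_lambda _ fun i => hY N i i.2
  have hZ' : Measurable fun ω (i : J) => Z ω i := measurable_pi_lambda _ fun i => hZ i i.2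
  -- Characteristic functions are taken in an inner product space, hence the passage through the
  -- Euclidean norm and back.
  have key : TendstoInDistribution (fun N ω => WithLp.toLp 2 fun (i : J) => Y N ω i) atTop
      (fun ω => WithLp.toLp 2 fun (i : J) => Z ω i) P Q := by
    have hm := (PiLp.continuous_toLp 2 fun _ : J => ℝ).measurable
    have hmY : ∀ N, AEMeasurable (fun ω => WithLp.toLp 2 fun (i : J) => Y N ω i) (P N) :=
      fun N => (hm.comp (hY' N)).aemeasurable
    have hmZ : AEMeasurable (fun ω => WithLp.toLp 2 fun (i : J) => Z ω i) Q :=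
      (hm.comp hZ').aemeasurable
    refine ⟨hmY, hmZ, ?_⟩
    refine ProbabilityMeasure.tendsto_of_tendsto_charFun fun t => ?_
    convert h (extendZero J t.ofLp) using 2 with N
    · rw [ProbabilityMeasure.coe_mk, charFun_apply, integral_map (hmY N) (by fun_prop)]
      congr! 5 with ω
      rw [← Finset.sum_coe_sort J, PiLp.inner_apply]
      simp [extendZero]
    · rw [ProbabilityMeasure.coe_mk, charFun_apply, integral_map hmZ (by fun_prop)]
      congr! 5 with ω
      rw [← Finset.sum_coe_sort J, PiLp.inner_apply]
      simp [extendZero]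
  exact TendstoInDistribution.continuous_comp (PiLp.continuous_ofLp 2 _) key

lemma TendstoOnCoords.tendsto_lintegral (h : TendstoOnCoords J Y Z P Q) {φ : (ι → ℝ) → ℝ}
    (hφ : Continuous φ) (hJ : DependsOn φ (J : Set ι)) :
    Tendsto (fun N => ∫⁻ ω, min 1 (ENNReal.ofReal (φ (Y N ω))) ∂(P N)) atTop
      (𝓝 (∫⁻ ω, min 1 (ENNReal.ofReal (φ (Z ω))) ∂Q)) := by
  have h1 := (ProbabilityMeasure.tendsto_iff_forall_lintegral_tendsto).1
    (h.continuous_comp hφ hJ).tendsto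
  let f : BoundedContinuousFunction ℝ NNReal :=
    BoundedContinuousFunction.mkOfBound ⟨fun x => min 1 x.toNNReal, by fun_prop⟩ 1 (by
      intro x y
      rw [NNReal.dist_eq, abs_le]
      have h1 : ∀ z : ℝ, ((min 1 z.toNNReal : NNReal) : ℝ) ≤ 1 := fun z => by
        exact_mod_cast min_le_left _ _
      have h2 : ∀ z : ℝ, (0 : ℝ) ≤ (min 1 z.toNNReal : NNReal) := fun z => NNReal.coe_nonneg _
      constructor
      · have := h1 y; have := h2 x; simp only [ContinuousMap.coe_mk]; linarith
      · have := h1 x; have := h2 y; simp only [ContinuousMap.coe_mk]; linarith)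
  have hf : ∀ x, (f x : ENNReal) = min 1 (ENNReal.ofReal x) := fun x => by
    simp [f, ENNReal.ofReal]
  specialize h1 f
  simp only [ProbabilityMeasure.coe_mk] at h1
  rw [lintegral_map' (by fun_prop) (h.continuous_comp hφ hJ).aemeasurable_limit] at h1
  simp_rw [fun N => lintegral_map' (μ := P N) (f := fun x => (f x : ENNReal)) (by fun_prop)
    ((h.continuous_comp hφ hJ).forall_aemeasurable N)] at h1
  simpa [hf] using h1

/-- Tightness inherited from the limit: `δ K(Z)` tends to zero with `δ`, so some `δ = 1/(n+1)` makes
its truncated expectation less than `ε`, and weak convergence transfers this to large `N`. -/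
lemma TendstoOnCoords.bddInProb (h : TendstoOnCoords J Y Z P Q) {K : (ι → ℝ) → ℝ}
    (hK : Continuous K) (hJ : DependsOn K (J : Set ι)) :
    BddInProb P (fun N ω => K (Y N ω)) := by
  intro ε hε
  have hlim : Tendsto (fun n : ℕ => ∫⁻ ω, min 1 (ENNReal.ofReal (1 / ((n : ℝ) + 1) * K (Z ω))) ∂Q)
      atTop (𝓝 (∫⁻ _, 0 ∂Q)) := by
    have hKm : AEMeasurable (fun ω => K (Z ω)) Q := (h.continuous_comp hK hJ).aemeasurable_limit
    refine tendsto_lintegral_of_dominated_convergence' (fun _ => 1)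
      (fun n => aemeasurable_const.min (hKm.const_mul _).ennreal_ofReal)
      (fun n => .of_forall fun ω => min_le_left _ _) (by simp) (.of_forall fun ω => ?_)
    have h1 := (tendsto_one_div_add_atTop_nhds_zero_nat (𝕜 := ℝ)).mul_const (K (Z ω))
    have h2 := (tendsto_const_nhds (x := (1 : ENNReal))).min (ENNReal.tendsto_ofReal h1)
    simpa using h2
  rw [lintegral_zero] at hlim
  obtain ⟨n, hn⟩ := (hlim.eventually_lt_const hε).exists
  refine ⟨1 / ((n : ℝ) + 1), by positivity, ?_⟩
  have h1 := h.tendsto_lintegral (φ := fun y => 1 / ((n : ℝ) + 1) * K y) (by fun_prop)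
    (fun x y hxy => by simp only [hJ hxy])
  filter_upwards [h1.eventually_lt_const hn] with N hN using hN.le

/-- The truncated expectation of the negative part is a continuous functional that is eventually
zero along the sequence, so it is zero in the limit. -/
lemma TendstoOnCoords.ae_nonneg (h : TendstoOnCoords J Y Z P Q) {i : ι} (hi : i ∈ J)
    (hY : ∀ᶠ N in atTop, ∀ ω, 0 ≤ Y N ω i) : ∀ᵐ ω ∂Q, 0 ≤ Z ω i := by
  have hc : Continuous fun y : ι → ℝ => -y i := by fun_prop
  have hJ : DependsOn (fun y : ι → ℝ => -y i) (J : Set ι) := fun x y hxy => by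
    simp only [hxy i hi]
  have h1 := h.tendsto_lintegral hc hJ
  have h2 : Tendsto (fun N => ∫⁻ ω, min 1 (ENNReal.ofReal (-Y N ω i)) ∂(P N)) atTop (𝓝 0) := by
    refine tendsto_const_nhds.congr' ?_
    filter_upwards [hY] with N hN
    simp [fun ω => ENNReal.ofReal_eq_zero.2 (neg_nonpos.2 (hN ω))]
  have h3 := tendsto_nhds_unique h1 h2
  have hm := (h.continuous_comp hc hJ).aemeasurable_limit
  rw [lintegral_eq_zero_iff' (by fun_prop)] at h3
  filter_upwards [h3] with ω hω
  have : ENNReal.ofReal (-Z ω i) = 0 := by simpa using hω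
  simpa using this

end TendstoOnCoords

/-! ### Conditioning on the past and the Poisson approximation of characteristic functions. -/

/-- The freezing principle: the pair has a product law, so Fubini allows integration over the
independent variable with the known one held fixed. -/
lemma integral_comp_of_indep {𝕜 Ω 𝓦 𝓤 : Type*} [RCLike 𝕜] {m mΩ : MeasurableSpace Ω} [MeasurableSpace 𝓦]
    [MeasurableSpace 𝓤] {P : Measure Ω} [IsProbabilityMeasure P] (hm : m ≤ mΩ)
    {W : Ω → 𝓦} {U : Ω → 𝓤} (hW : Measurable[m] W) (hU : Measurable U)
    (hind : Indep (MeasurableSpace.comap U inferInstance) m P) {Ψ : 𝓦 → 𝓤 → 𝕜}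
    (hΨ : Measurable (Function.uncurry Ψ)) {c : ℝ} (hc : ∀ w u, ‖Ψ w u‖ ≤ c) :
    ∫ ω, Ψ (W ω) (U ω) ∂P = ∫ ω, ∫ u, Ψ (W ω) u ∂(P.map U) ∂P := by
  have hW' : Measurable W := hW.mono hm le_rfl
  have hWU : IndepFun W U P := by
    rw [IndepFun_iff_Indep]
    exact indep_of_indep_of_le_left hind.symm hW.comap_le
  have h1 := hWU.map_prod_eq_prod_map_map hW'.aemeasurable hU.aemeasurable
  have : IsProbabilityMeasure (P.map U) := Measure.isProbabilityMeasure_map hU.aemeasurable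
  have : IsProbabilityMeasure (P.map W) := Measure.isProbabilityMeasure_map hW'.aemeasurable
  have hint : Integrable (Function.uncurry Ψ) ((P.map W).prod (P.map U)) :=
    Integrable.of_bound hΨ.aestronglyMeasurable c (.of_forall fun x => hc _ _)
  calc ∫ ω, Ψ (W ω) (U ω) ∂P = ∫ x, Function.uncurry Ψ x ∂(P.map fun ω => (W ω, U ω)) := by
        rw [integral_map (hW'.prodMk hU).aemeasurable hΨ.aestronglyMeasurable]; rfl
    _ = ∫ w, ∫ u, Ψ w u ∂(P.map U) ∂(P.map W) := by rw [h1, integral_prod _ hint]; rfl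
    _ = _ := by
        rw [integral_map hW'.aemeasurable]
        exact hΨ.stronglyMeasurable.integral_prod_right.aestronglyMeasurable

lemma norm_ite_le_one {c : Prop} [Decidable c] {w : ℂ} (hw : ‖w‖ ≤ 1) :
    ‖if c then w else 1‖ ≤ 1 := by
  split_ifs <;> simp [hw]

lemma integral_ite_le_uniform {p : ℝ} (hp : p ∈ Set.Icc (0 : ℝ) 1) (w : ℂ) :
    ∫ u in Set.Icc (0 : ℝ) 1, (if u ≤ p then w else 1) = 1 + p * (w - 1) := by
  have h1 : ∀ u : ℝ, (if u ≤ p then w else 1) = 1 + (Set.Iic p).indicator (fun _ => w - 1) u := by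
    intro u
    by_cases h : u ≤ p <;> simp [Set.indicator, h]
  simp_rw [h1]
  rw [integral_add (by simp) ((integrable_const _).indicator measurableSet_Iic),
    integral_indicator measurableSet_Iic, Measure.restrict_restrict measurableSet_Iic]
  have h2 : Set.Iic p ∩ Set.Icc (0 : ℝ) 1 = Set.Icc 0 p := by
    ext u; simp only [Set.mem_inter_iff, Set.mem_Iic, Set.mem_Icc]
    exact ⟨fun h => ⟨h.2.1, h.1⟩, fun h => ⟨h.2, h.1, h.2.trans hp.2⟩⟩
  rw [h2]
  simp [hp.1]

lemma integral_mul_prod_ite_le {Ω : Type*} {N : ℕ} {m mΩ : MeasurableSpace Ω} {P : Measure Ω}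
    [IsProbabilityMeasure P] (hm : m ≤ mΩ) {p u : Fin N → Ω → ℝ} {V : Ω → ℂ}
    (hV : Measurable[m] V) (hV1 : ∀ ω, ‖V ω‖ ≤ 1) (hp : ∀ i, Measurable[m] (p i))
    (hp1 : ∀ i ω, p i ω ∈ Set.Icc (0 : ℝ) 1) (hu : ∀ i, Measurable (u i))
    (hlaw : ∀ i, P.map (u i) = volume.restrict (Set.Icc (0 : ℝ) 1)) (hiind : iIndepFun u P)
    (hind : Indep (MeasurableSpace.comap (fun ω i => u i ω) MeasurableSpace.pi) m P)
    {w : ℂ} (hw : ‖w‖ ≤ 1) :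
    ∫ ω, V ω * ∏ i, (if u i ω ≤ p i ω then w else 1) ∂P =
      ∫ ω, V ω * ∏ i, (1 + p i ω * (w - 1)) ∂P := by
  have hW : Measurable[m] fun ω => (V ω, fun i => p i ω) := by
    exact hV.prodMk (@measurable_pi_lambda _ _ _ m _ _ hp)
  -- Clipping makes the integrand bounded for all arguments, as the freezing principle requires; it
  -- does not change `V`, which stays in the unit disc.
  let clip : ℂ → ℂ := fun v => if ‖v‖ ≤ 1 then v else 0
  have hclip : Measurable clip := Measurable.ite (measurableSet_le (by fun_prop) (by fun_prop))
    measurable_id measurable_const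
  have hclip1 : ∀ v, ‖clip v‖ ≤ 1 := fun v => by
    by_cases h : ‖v‖ ≤ 1 <;> simp [clip, h]
  have hclipV : ∀ ω, clip (V ω) = V ω := fun ω => by simp [clip, hV1 ω]
  let Ψ : ℂ × (Fin N → ℝ) → (Fin N → ℝ) → ℂ :=
    fun x y => clip x.1 * ∏ i, (if y i ≤ x.2 i then w else 1)
  have hΨ : Measurable (Function.uncurry Ψ) := by
    refine (hclip.comp (by fun_prop)).mul (Finset.measurable_prod _ fun i _ => ?_)
    exact Measurable.ite (measurableSet_le (by fun_prop) (by fun_prop)) measurable_const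
      measurable_const
  have key := integral_comp_of_indep (Ψ := Ψ) (c := 1) hm hW (measurable_pi_lambda _ hu) hind hΨ
    (fun x y => by
      simp only [Ψ, norm_mul, norm_prod]
      refine mul_le_one₀ (hclip1 _) (by positivity) (Finset.prod_le_one (fun _ _ => by positivity)
        fun i _ => norm_ite_le_one hw))
  simp only [Ψ, hclipV] at key
  rw [key, hiind.map_fun_eq_pi_map fun i => (hu i).aemeasurable]
  simp_rw [hlaw]
  refine integral_congr_ae (.of_forall fun ω => ?_)
  simp only
  rw [integral_const_mul]
  congr 1
  rw [integral_fintype_prod_eq_prod (μ := fun _ => volume.restrict (Set.Icc (0 : ℝ) 1))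
    (f := fun i y => if y ≤ p i ω then w else 1)]
  exact Finset.prod_congr rfl fun i _ => integral_ite_le_uniform (hp1 i ω) w

/-- Exchange one factor at a time; all the other factors have norm at most 1. -/
lemma norm_prod_sub_prod_le_sum {ι : Type*} (s : Finset ι) {a b : ι → ℂ} (ha : ∀ i, ‖a i‖ ≤ 1)
    (hb : ∀ i, ‖b i‖ ≤ 1) : ‖∏ i ∈ s, a i - ∏ i ∈ s, b i‖ ≤ ∑ i ∈ s, ‖a i - b i‖ := by
  classical
  induction s using Finset.induction_on with
  | empty => simp
  | insert j s hj ih =>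
    rw [Finset.prod_insert hj, Finset.prod_insert hj, Finset.sum_insert hj]
    have h1 : a j * ∏ i ∈ s, a i - b j * ∏ i ∈ s, b i =
      (a j - b j) * ∏ i ∈ s, a i + b j * (∏ i ∈ s, a i - ∏ i ∈ s, b i) := by ring
    rw [h1]
    refine (norm_add_le _ _).trans (add_le_add ?_ ?_)
    · rw [norm_mul, norm_prod]
      exact mul_le_of_le_one_right (norm_nonneg _)
        (Finset.prod_le_one (fun _ _ => norm_nonneg _) fun i _ => ha i)
    · rw [norm_mul]
      exact (mul_le_of_le_one_left (norm_nonneg _) (hb j)).trans ih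

lemma norm_one_add_mul_sub_one_le {p : ℝ} (hp : p ∈ Set.Icc (0 : ℝ) 1) {w : ℂ} (hw : ‖w‖ ≤ 1) :
    ‖1 + (p : ℂ) * (w - 1)‖ ≤ 1 := by
  have h1 : 1 + (p : ℂ) * (w - 1) = ((1 - p : ℝ) : ℂ) + p * w := by push_cast; ring
  rw [h1]
  refine (norm_add_le _ _).trans ?_
  rw [norm_mul, Complex.norm_real, Complex.norm_real, Real.norm_of_nonneg hp.1,
    Real.norm_of_nonneg (sub_nonneg.2 hp.2)]
  nlinarith [hp.1]

lemma norm_exp_mul_sub_one_le_one {p : ℝ} (hp : 0 ≤ p) {w : ℂ} (hw : ‖w‖ ≤ 1) :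
    ‖Complex.exp ((p : ℂ) * (w - 1))‖ ≤ 1 := by
  rw [Complex.norm_exp, Real.exp_le_one_iff]
  have := (Complex.re_le_norm w).trans hw
  simp only [Complex.mul_re, Complex.ofReal_re, Complex.sub_re, Complex.one_re, Complex.ofReal_im,
    zero_mul, sub_zero]
  exact mul_nonpos_of_nonneg_of_nonpos hp (by linarith)

/-- Factor by factor, with `z = p (w - 1)` and `‖z‖ ≤ 2p`. If `2p ≤ 1`, the second-order remainder
of the exponential is at most `‖z‖² ≤ 4p²`. If `2p ≥ 1`, the trivial bound 2 is at most `8p²`, which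
fixes the constant. -/
lemma norm_prod_sub_exp_sum_le {N : ℕ} {p : Fin N → ℝ} (hp : ∀ i, p i ∈ Set.Icc (0 : ℝ) 1) {w : ℂ}
    (hw : ‖w‖ ≤ 1) :
    ‖∏ i, (1 + (p i : ℂ) * (w - 1)) - Complex.exp ((∑ i, p i : ℝ) * (w - 1))‖ ≤
      8 * ∑ i, p i ^ 2 := by
  have h1 : Complex.exp ((∑ i, p i : ℝ) * (w - 1)) = ∏ i, Complex.exp ((p i : ℂ) * (w - 1)) := by
    rw [← Complex.exp_sum, ← Finset.sum_mul]; push_cast; rfl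
  rw [h1, Finset.mul_sum]
  refine (norm_prod_sub_prod_le_sum _ (fun i => norm_one_add_mul_sub_one_le (hp i) hw)
    fun i => norm_exp_mul_sub_one_le_one (hp i).1 hw).trans (Finset.sum_le_sum fun i _ => ?_)
  have hz : ‖w - 1‖ ≤ 2 := (norm_sub_le _ _).trans (by rw [norm_one]; linarith)
  have hpz : ‖(p i : ℂ) * (w - 1)‖ ≤ 2 * p i := by
    rw [norm_mul, Complex.norm_real, Real.norm_of_nonneg (hp i).1]
    nlinarith [(hp i).1]
  rcases le_total (2 * p i) 1 with h | h
  · have h2 := Complex.norm_exp_sub_one_sub_id_le (hpz.trans h)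
    rw [norm_sub_rev]
    have h3 : Complex.exp ((p i : ℂ) * (w - 1)) - (1 + (p i : ℂ) * (w - 1)) =
      Complex.exp ((p i : ℂ) * (w - 1)) - 1 - (p i : ℂ) * (w - 1) := by ring
    rw [h3]
    refine h2.trans ?_
    have := pow_le_pow_left₀ (norm_nonneg _) hpz 2
    nlinarith [sq_nonneg (p i)]
  · have h2 := norm_sub_le (1 + (p i : ℂ) * (w - 1)) (Complex.exp ((p i : ℂ) * (w - 1)))
    have := norm_one_add_mul_sub_one_le (hp i) hw
    have := norm_exp_mul_sub_one_le_one (hp i).1 hw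
    nlinarith

lemma norm_exp_ofReal_mul_I_sub_le (x y : ℝ) :
    ‖Complex.exp (x * Complex.I) - Complex.exp (y * Complex.I)‖ ≤ |x - y| := by
  have h1 : Complex.exp (x * Complex.I) - Complex.exp (y * Complex.I) =
      Complex.exp (y * Complex.I) * (Complex.exp (Complex.I * (x - y : ℝ)) - 1) := by
    rw [mul_sub, ← Complex.exp_add, mul_one]; push_cast; ring_nf
  rw [h1, norm_mul, Complex.norm_exp_ofReal_mul_I, one_mul]
  exact Real.norm_exp_I_mul_ofReal_sub_one_le

/-! ### Adding one coordinate to a jointly convergent vector. -/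

section Steps

variable {ι : Type*} {Ω : ℕ → Type*} [∀ N, MeasurableSpace (Ω N)] {Ω' : Type*}
  [MeasurableSpace Ω'] {J : Finset ι} {Y : ∀ N, Ω N → ι → ℝ} {Z : Ω' → ι → ℝ}
  {P : ∀ N, Measure (Ω N)} [∀ N, IsProbabilityMeasure (P N)]
  {Q : Measure Ω'} [IsProbabilityMeasure Q]

lemma dependsOn_linear (J : Finset ι) (a : ι → ℝ) {x y : ι → ℝ} (h : ∀ i ∈ (J : Set ι), x i = y i) :
    ∑ i ∈ J, a i * x i = ∑ i ∈ J, a i * y i :=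
  Finset.sum_congr rfl fun i hi => by rw [h i hi]

lemma integrable_exp_mul_I {Ω : Type*} [MeasurableSpace Ω] {P : Measure Ω} [IsFiniteMeasure P]
    {f : Ω → ℝ} (hf : Measurable f) : Integrable (fun ω => Complex.exp (f ω * Complex.I)) P :=
  Integrable.of_bound (by fun_prop) 1
    (.of_forall fun ω => (Complex.norm_exp_ofReal_mul_I _).le)

/-- A coordinate which is, up to a negligible error, a continuous function of coordinates that
converge jointly in distribution, converges jointly with them. -/
lemma TendstoOnCoords.insert_of_negligible [DecidableEq ι] (h : TendstoOnCoords J Y Z P Q) {i : ι}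
    (hY : ∀ N, ∀ j ∈ insert i J, Measurable fun ω => Y N ω j)
    (hZ : ∀ j ∈ insert i J, Measurable fun ω => Z ω j)
    {F : (ι → ℝ) → ℝ} (hF : Continuous F) (hFJ : DependsOn F (J : Set ι))
    {R : ∀ N, Ω N → ℝ} (hR : Negligible P R)
    (hle : ∀ᶠ N in atTop, ∀ ω, |Y N ω i - F (Y N ω)| ≤ R N ω) (hZF : ∀ ω, Z ω i = F (Z ω)) :
    TendstoOnCoords (insert i J) Y Z P Q := by
  by_cases hi : i ∈ J
  · rwa [Finset.insert_eq_of_mem hi]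
  refine tendstoOnCoords_of_charFun hY hZ fun a => ?_
  simp only [Finset.sum_insert hi]
  have hFm : ∀ N, Measurable fun ω => F (Y N ω) := fun N => by
    have : (fun ω => F (Y N ω)) = fun ω => F (extendZero J fun j => Y N ω j) := by
      funext ω; rw [hFJ.extendZero_eq]
    rw [this]
    exact (hF.comp (continuous_extendZero J)).measurable.comp
      (measurable_pi_lambda _ fun j => hY N j (by simp))
  have hs : ∀ N, Measurable fun ω => ∑ j ∈ J, a j * Y N ω j := fun N =>
    Finset.measurable_sum _ fun j hj => (hY N j (by simp [hj])).const_mul _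
  have h1 := h.tendsto_integral
    (φ := fun y => Complex.exp ((a i * F y + ∑ j ∈ J, a j * y j : ℝ) * Complex.I)) (by fun_prop)
    (fun x y hxy => by simp only [hFJ hxy, dependsOn_linear J a hxy]) (c := 1)
    (fun y => (Complex.norm_exp_ofReal_mul_I _).le)
  -- Replacing the new coordinate by `F` of the old ones changes the characteristic function by a
  -- negligible amount.
  have h2 := (hR.const_mul (abs_nonneg (a i))).tendsto_integral_sub
    (A := fun N ω => Complex.exp ((a i * Y N ω i + ∑ j ∈ J, a j * Y N ω j : ℝ) * Complex.I))
    (B := fun N ω => Complex.exp ((a i * F (Y N ω) + ∑ j ∈ J, a j * Y N ω j : ℝ) * Complex.I))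
    (.of_forall fun N => integrable_exp_mul_I (((hY N i (by simp)).const_mul _).add (hs N)))
    (.of_forall fun N => integrable_exp_mul_I (((hFm N).const_mul _).add (hs N)))
    (by
      filter_upwards [hle] with N hN ω
      refine (norm_exp_ofReal_mul_I_sub_le _ _).trans ?_
      rw [add_sub_add_right_eq_sub, ← mul_sub, abs_mul]
      exact mul_le_mul_of_nonneg_left (hN ω) (abs_nonneg _))
    (.of_forall fun N ω => (norm_sub_le _ _).trans (by
      rw [Complex.norm_exp_ofReal_mul_I, Complex.norm_exp_ofReal_mul_I]; norm_num))
  have h3 := h2.add h1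
  simpa only [sub_add_cancel, zero_add, hZF] using h3

/-- A coordinate with asymptotically the conditional characteristic function of the Poisson
distribution with intensity `Y N ω l`, given coordinates that converge jointly in distribution,
converges jointly with them. -/
lemma TendstoOnCoords.insert_of_poisson [DecidableEq ι] (h : TendstoOnCoords J Y Z P Q) {i l : ι} (hl : l ∈ J)
    (hi : i ∉ J) (hY : ∀ N, ∀ j ∈ insert i J, Measurable fun ω => Y N ω j)
    (hZ : ∀ j ∈ insert i J, Measurable fun ω => Z ω j)
    (hl0 : ∀ᶠ N in atTop, ∀ ω, 0 ≤ Y N ω l)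
    (hYi : ∀ (a : ι → ℝ) (b : ℝ), Tendsto (fun N =>
      ∫ ω, Complex.exp ((∑ j ∈ J, a j * Y N ω j : ℝ) * Complex.I) *
          Complex.exp ((b * Y N ω i : ℝ) * Complex.I) ∂(P N) -
        ∫ ω, Complex.exp ((∑ j ∈ J, a j * Y N ω j : ℝ) * Complex.I) *
          Complex.exp (Y N ω l * (Complex.exp (b * Complex.I) - 1)) ∂(P N)) atTop (𝓝 0))
    (hZi : ∀ (a : ι → ℝ) (b : ℝ),
      ∫ ω, Complex.exp ((∑ j ∈ J, a j * Z ω j : ℝ) * Complex.I) *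
          Complex.exp ((b * Z ω i : ℝ) * Complex.I) ∂Q =
        ∫ ω, Complex.exp ((∑ j ∈ J, a j * Z ω j : ℝ) * Complex.I) *
          Complex.exp ((max (Z ω l) 0 : ℝ) * (Complex.exp (b * Complex.I) - 1)) ∂Q) :
    TendstoOnCoords (insert i J) Y Z P Q := by
  refine tendstoOnCoords_of_charFun hY hZ fun a => ?_
  have hsplit : ∀ y : ι → ℝ, Complex.exp ((∑ j ∈ insert i J, a j * y j : ℝ) * Complex.I) =
      Complex.exp ((∑ j ∈ J, a j * y j : ℝ) * Complex.I) *
        Complex.exp ((a i * y i : ℝ) * Complex.I) := fun y => by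
    rw [← Complex.exp_add, Finset.sum_insert hi]; push_cast; ring_nf
  simp only [hsplit]
  rw [hZi]
  -- The positive part keeps the test function bounded on the whole space; it is harmless along the
  -- sequence, where coordinate `l` is eventually nonnegative.
  have h1 := h.tendsto_integral
    (φ := fun y => Complex.exp ((∑ j ∈ J, a j * y j : ℝ) * Complex.I) *
          Complex.exp ((max (y l) 0 : ℝ) * (Complex.exp (a i * Complex.I) - 1))) (by fun_prop)
    (fun x y hxy => by simp only [hxy l hl, dependsOn_linear J a hxy]) (c := 1)
    (fun y => by
      rw [norm_mul, Complex.norm_exp_ofReal_mul_I, one_mul]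
      exact norm_exp_mul_sub_one_le_one (le_max_right _ _) (Complex.norm_exp_ofReal_mul_I _).le)
  have h2 := (hYi a (a i)).add h1
  rw [zero_add] at h2
  refine h2.congr' ?_
  filter_upwards [hl0] with N hN
  simp only [fun ω => max_eq_left (hN ω)]
  exact sub_add_cancel _ _

end Steps

lemma abs_dotProduct_le {ι : Type*} [Fintype ι] (a b : ι → ℝ) :
    |a ⬝ᵥ b| ≤ Fintype.card ι * (‖a‖ * ‖b‖) := by
  refine (Finset.abs_sum_le_sum_abs _ _).trans ?_
  rw [← Finset.card_univ, ← nsmul_eq_mul]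
  refine Finset.sum_le_card_nsmul _ _ _ fun i _ => ?_
  rw [abs_mul]
  exact mul_le_mul (norm_le_pi_norm a i) (norm_le_pi_norm b i) (abs_nonneg _) (norm_nonneg _)

/-! ### First- and second-order bounds at the corner of the cube. -/

section Taylor

variable {s : ℕ}

lemma convex_lagCube (s : ℕ) : Convex ℝ (lagCube s) := convex_Icc _ _

lemma zero_mem_lagCube (s : ℕ) : (0 : LagSpace s) ∈ lagCube s := ⟨le_rfl, zero_le_one⟩

lemma uniqueDiffOn_lagCube (s : ℕ) : UniqueDiffOn ℝ (lagCube s) := by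
  rw [lagCube, ← Set.pi_univ_Icc]
  exact UniqueDiffOn.univ_pi fun i => uniqueDiffOn_Icc (by simp)

lemma fderivWithin_zero_eq_gradAtZero_dotProduct (f : LagSpace s → ℝ) (x : LagSpace s) :
    fderivWithin ℝ f (lagCube s) 0 x = gradAtZero f ⬝ᵥ x := by
  conv_lhs => rw [← Finset.univ_sum_single x]
  rw [map_sum, dotProduct]
  refine Finset.sum_congr rfl fun j _ => ?_
  have : (Pi.single j (x j) : LagSpace s) = x j • Pi.single j 1 := by
    rw [← Pi.single_smul]; simp
  rw [this, map_smul, gradAtZero, smul_eq_mul, mul_comm]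

lemma abs_le_of_norm_fderivWithin_le {f : LagSpace s → ℝ} {M : ℝ}
    (hf : ContDiffOn ℝ 2 f (lagCube s))
    (hM : ∀ x ∈ lagCube s, ‖fderivWithin ℝ f (lagCube s) x‖ ≤ M) (h0 : f 0 = 0) {x : LagSpace s}
    (hx : x ∈ lagCube s) : |f x| ≤ M * ‖x‖ := by
  have := (convex_lagCube s).norm_image_sub_le_of_norm_fderivWithin_le
    (hf.differentiableOn (by simp)) hM (zero_mem_lagCube s) hx
  simpa [h0] using this

/-- The Hessian bound makes the derivative `M`-Lipschitz from the origin, so on the segment from `0`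
to `x` it varies by at most `M ‖x‖`. The mean value inequality on that segment gives another factor
`‖x‖`. -/
lemma abs_sub_gradAtZero_dotProduct_le {f : LagSpace s → ℝ} {M : ℝ}
    (hf : ContDiffOn ℝ 2 f (lagCube s))
    (hM : ∀ x ∈ lagCube s, ‖iteratedFDerivWithin ℝ 2 f (lagCube s) x‖ ≤ M) (h0 : f 0 = 0)
    {x : LagSpace s} (hx : x ∈ lagCube s) : |f x - gradAtZero f ⬝ᵥ x| ≤ M * ‖x‖ ^ 2 := by
  have hM0 : 0 ≤ M := (norm_nonneg _).trans (hM 0 (zero_mem_lagCube s))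
  have hd : DifferentiableOn ℝ f (lagCube s) := hf.differentiableOn (by simp)
  have hd' : DifferentiableOn ℝ (fderivWithin ℝ f (lagCube s)) (lagCube s) :=
    (hf.fderivWithin (m := 1) (uniqueDiffOn_lagCube s) (by norm_num)).differentiableOn (by simp)
  have hlip : ∀ y ∈ lagCube s,
      ‖fderivWithin ℝ f (lagCube s) y - fderivWithin ℝ f (lagCube s) 0‖ ≤ M * ‖y‖ := by
    intro y hy
    have := (convex_lagCube s).norm_image_sub_le_of_norm_fderivWithin_le (C := M) hd' (fun z hz => ?_)
      (zero_mem_lagCube s) hy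
    · simpa using this
    · rw [← norm_iteratedFDerivWithin_one _ (uniqueDiffOn_lagCube s z hz),
        norm_iteratedFDerivWithin_fderivWithin (uniqueDiffOn_lagCube s) hz]
      exact hM z hz
  have hseg : segment ℝ 0 x ⊆ lagCube s := (convex_lagCube s).segment_subset (zero_mem_lagCube s) hx
  have := (convex_segment (𝕜 := ℝ) (0 : LagSpace s) x).norm_image_sub_le_of_norm_hasFDerivWithin_le'
    (f := f) (f' := fderivWithin ℝ f (lagCube s)) (φ := fderivWithin ℝ f (lagCube s) 0)
    (C := M * ‖x‖)
    (fun y hy => (hd y (hseg hy)).hasFDerivWithinAt.mono hseg) (fun y hy => ?_)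
    (left_mem_segment ℝ 0 x) (right_mem_segment ℝ 0 x)
  · rw [sub_zero, h0, sub_zero, fderivWithin_zero_eq_gradAtZero_dotProduct] at this
    rw [sq, ← mul_assoc]
    exact this
  · refine (hlip y (hseg hy)).trans (mul_le_mul_of_nonneg_left ?_ hM0)
    obtain ⟨a, b, ha, hb, hab, rfl⟩ := hy
    rw [smul_zero, zero_add, norm_smul, Real.norm_of_nonneg hb]
    exact mul_le_of_le_one_left (norm_nonneg _) (by linarith)

end Taylor

/-! ### Standing assumptions and elementary properties of model paths. -/

/-- Bounds on the coefficients and regularity of the functions of the model. -/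
structure GABCoeffs.Regular {s k : ℕ} (θ : GABCoeffs s k) (C A M : ℝ) : Prop where
  c_mem : ∀ i, 0 ≤ θ.c i ∧ θ.c i ≤ C
  norm_γ_le : ∀ i, ‖θ.γ i‖ ≤ C
  fα_le : ∀ i v, |θ.fα i v| ≤ A * ∑ τ, ((v τ : ℕ) : ℝ)
  fγi_smooth : ∀ i, ContDiffOn ℝ 2 (θ.fγi i) (lagCube s)
  fγi_grad : ∀ i, ∀ x ∈ lagCube s, ‖fderivWithin ℝ (θ.fγi i) (lagCube s) x‖ ≤ M
  fγi_hess : ∀ i, ∀ x ∈ lagCube s, ‖iteratedFDerivWithin ℝ 2 (θ.fγi i) (lagCube s) x‖ ≤ M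
  fγi_zero : ∀ i, θ.fγi i 0 = 0
  fγ_continuousOn : ContinuousOn θ.fγ (lagOrthant s)

/-- The function `fγ` extended from the orthant to the whole space. -/
noncomputable def GABCoeffs.fγExt {s k : ℕ} (θ : GABCoeffs s k) (x : LagSpace s) : Fin k → ℝ :=
  θ.fγ (x ⊔ 0)

lemma GABCoeffs.fγExt_eq {s k : ℕ} (θ : GABCoeffs s k) {x : LagSpace s} (hx : 0 ≤ x) :
    θ.fγExt x = θ.fγ x := by
  rw [GABCoeffs.fγExt, sup_eq_left.2 hx]

section Regular

variable {s k : ℕ} {θ : GABCoeffs s k} {C A M : ℝ}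

lemma GABCoeffs.Regular.continuous_fγExt (hθ : θ.Regular C A M) : Continuous θ.fγExt :=
  hθ.fγ_continuousOn.comp_continuous
    (continuous_pi fun i => (continuous_apply i).max continuous_const)
    fun _ => Set.mem_Ici.2 le_sup_right

lemma GABCoeffs.Regular.nonneg_C (hθ : θ.Regular C A M) : 0 ≤ C :=
  (hθ.c_mem 0).1.trans (hθ.c_mem 0).2

lemma GABCoeffs.Regular.nonneg_M (hθ : θ.Regular C A M) : 0 ≤ M :=
  (norm_nonneg _).trans (hθ.fγi_grad 0 0 (zero_mem_lagCube s))

end Regular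

section Path

variable {s k N : ℕ} {θ : GABCoeffs s k} {C A M : ℝ} {Ω : Type*}

lemma outcome_mem (p u : ℤ → Fin N → Ω → ℝ) (t : ℤ) (i : Fin N) (ω : Ω) :
    ((outcome p u t i ω : ℕ) : ℝ) ∈ Set.Icc (0 : ℝ) 1 := by
  unfold outcome; split_ifs <;> simp

lemma successCount_mem (p u : ℤ → Fin N → Ω → ℝ) (t : ℤ) (ω : Ω) :
    successCount p u t ω ∈ Set.Icc (0 : ℝ) N := by
  refine ⟨Finset.sum_nonneg fun i _ => (outcome_mem p u t i ω).1, ?_⟩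
  refine (Finset.sum_le_card_nsmul _ _ 1 fun i _ => (outcome_mem p u t i ω).2).trans ?_
  simp

lemma measurable_outcome [MeasurableSpace Ω] {p u : ℤ → Fin N → Ω → ℝ} {t : ℤ} {i : Fin N}
    (hp : Measurable (p t i)) (hu : Measurable (u t i)) : Measurable (outcome p u t i) :=
  Measurable.ite (measurableSet_le hu hp) measurable_const measurable_const

lemma measurable_successCount [MeasurableSpace Ω] {p u : ℤ → Fin N → Ω → ℝ} {t : ℤ}
    (h : ∀ i, Measurable (outcome p u t i)) : Measurable (successCount p u t) :=
  Finset.measurable_sum _ fun i _ => (Measurable.of_discrete (f := fun y : Fin 2 => ((y : ℕ) : ℝ))).comp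
    (h i)

lemma measurable_probSum [MeasurableSpace Ω] {p : ℤ → Fin N → Ω → ℝ} {t : ℤ}
    (h : ∀ i, Measurable (p t i)) : Measurable (probSum p t) :=
  Finset.measurable_sum _ fun i _ => h i

lemma measurable_lagVector [MeasurableSpace Ω] {a b : ℤ → Ω → ℝ} {t : ℤ}
    (ha : ∀ τ : Fin s, Measurable (a (t - 1 - (τ : ℤ))))
    (hb : ∀ τ : Fin s, Measurable (b (t - 1 - (τ : ℤ)))) :
    Measurable fun ω => lagVector s (fun r => a r ω) (fun r => b r ω) t := by
  refine measurable_pi_lambda _ fun j => ?_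
  cases j with
  | inl τ => exact ha τ
  | inr τ => exact hb τ

lemma lag_ge {s : ℕ} {t : ℤ} (ht : 0 < t) (τ : Fin s) : 1 - (s : ℤ) ≤ t - 1 - (τ : ℤ) := by
  have := τ.2; omega

/-- The lagged success counts and sums of probabilities. -/
noncomputable def pathLags (s : ℕ) (p u : ℤ → Fin N → Ω → ℝ) (t : ℤ) (ω : Ω) : LagSpace s :=
  lagVector s (fun r => successCount p u r ω) (fun r => probSum p r ω) t

lemma lagVector_scaled (p u : ℤ → Fin N → Ω → ℝ) (t : ℤ) (ω : Ω) :
    lagVector s (fun r => 1 / N * successCount p u r ω) (fun r => 1 / N * probSum p r ω) t =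
      (1 / N : ℝ) • pathLags s p u t ω := by
  funext j
  cases j <;> rfl

lemma GABCoeffs.update_eq (p u : ℤ → Fin N → Ω → ℝ) (t : ℤ) (i : Fin N) (ω : Ω) :
    θ.update p u t i ω = θ.c i / N
    + 1 / (N : ℝ) ^ θ.κ * θ.fα i (fun τ => outcome p u (t - 1 - (τ : ℤ)) i ω)
    + ∑ τ : Fin s, θ.β τ * p (t - 1 - (τ : ℤ)) i ω
    + θ.fγi i ((1 / N : ℝ) • pathLags s p u t ω)
    + 1 / N * (θ.γ i ⬝ᵥ θ.fγ (pathLags s p u t ω)) := by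
  rw [GABCoeffs.update, lagVector_scaled, pathLags]

variable [MeasurableSpace Ω] {P : Measure Ω} {p u : ℤ → Fin N → Ω → ℝ}

lemma IsGABPath.probSum_mem (h : IsGABPath θ P p u) {t : ℤ} (ht : 1 - (s : ℤ) ≤ t) (ω : Ω) :
    probSum p t ω ∈ Set.Icc (0 : ℝ) N := by
  refine ⟨Finset.sum_nonneg fun i _ => (h.prob_mem t ht i ω).1, ?_⟩
  refine (Finset.sum_le_card_nsmul _ _ 1 fun i _ => (h.prob_mem t ht i ω).2).trans ?_
  simp

lemma IsGABPath.pathLags_mem (h : IsGABPath θ P p u) {t : ℤ} (ht : 0 < t) (ω : Ω) (j : Fin s ⊕ Fin s) :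
    pathLags s p u t ω j ∈ Set.Icc (0 : ℝ) N := by
  cases j with
  | inl τ => exact successCount_mem p u _ ω
  | inr τ => exact h.probSum_mem (lag_ge ht τ) ω

lemma IsGABPath.pathLags_nonneg (h : IsGABPath θ P p u) {t : ℤ} (ht : 0 < t) (ω : Ω) :
    0 ≤ pathLags s p u t ω := fun j => (h.pathLags_mem ht ω j).1

lemma IsGABPath.scaled_mem_lagCube (h : IsGABPath θ P p u) {t : ℤ} (ht : 0 < t)
    (ω : Ω) : (1 / N : ℝ) • pathLags s p u t ω ∈ lagCube s := by
  constructor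
  · intro j
    exact mul_nonneg (by positivity) (h.pathLags_mem ht ω j).1
  · intro j
    have h1 := (h.pathLags_mem ht ω j).2
    simp only [Pi.smul_apply, smul_eq_mul, Pi.one_apply]
    rw [one_div_mul_eq_div]
    exact div_le_one_of_le₀ h1 (by positivity)

end Path

/-! ### Measurability of the probabilities with respect to the past. -/

section Measurability

variable {s k N : ℕ} {θ : GABCoeffs s k} {C A M : ℝ} {Ω : Type*}

/-- `fγi` is controlled only on the cube, so measurability comes from continuity of its restriction
there. -/
lemma GABCoeffs.Regular.measurable_fγi_comp [MeasurableSpace Ω] (hθ : θ.Regular C A M) (i : ℕ)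
    {g : Ω → LagSpace s} (hg : Measurable g) (hmem : ∀ ω, g ω ∈ lagCube s) :
    Measurable fun ω => θ.fγi i (g ω) := by
  have h1 := (continuousOn_iff_continuous_domRestrict.1 (hθ.fγi_smooth i).continuousOn).measurable
  exact h1.comp (hg.subtype_mk (h := hmem))

lemma GABCoeffs.Regular.measurable_update [MeasurableSpace Ω] (hθ : θ.Regular C A M)
    {p u : ℤ → Fin N → Ω → ℝ} {t : ℤ}
    (hp : ∀ (τ : Fin s) i, Measurable (p (t - 1 - (τ : ℤ)) i))
    (hy : ∀ (τ : Fin s) i, Measurable (outcome p u (t - 1 - (τ : ℤ)) i))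
    (h0 : ∀ ω, 0 ≤ pathLags s p u t ω)
    (hcube : ∀ ω, (1 / N : ℝ) • pathLags s p u t ω ∈ lagCube s) (i : Fin N) :
    Measurable fun ω => θ.update p u t i ω := by
  have hv : Measurable (pathLags s p u t) := measurable_lagVector
    (fun τ => measurable_successCount (hy τ)) (fun τ => measurable_probSum (hp τ))
  simp only [GABCoeffs.update_eq]
  have h1 : Measurable fun ω => θ.fα i (fun τ => outcome p u (t - 1 - (τ : ℤ)) i ω) :=
    (Measurable.of_discrete (f := θ.fα i)).comp (measurable_pi_lambda _ fun τ => hy τ i)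
  have h2 : Measurable fun ω => θ.fγi i ((1 / N : ℝ) • pathLags s p u t ω) :=
    hθ.measurable_fγi_comp i (hv.const_smul (1 / N : ℝ)) hcube
  have h3 : Measurable fun ω => θ.γ i ⬝ᵥ θ.fγ (pathLags s p u t ω) := by
    simp only [← fun ω => θ.fγExt_eq (h0 ω)]
    have h4 : Measurable fun ω => θ.fγExt (pathLags s p u t ω) :=
      hθ.continuous_fγExt.measurable.comp hv
    exact Finset.measurable_sum _ fun j _ => ((measurable_pi_apply j).comp h4).const_mul _
  have h5 : Measurable fun ω => ∑ τ : Fin s, θ.β τ * p (t - 1 - (τ : ℤ)) i ω :=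
    Finset.measurable_sum _ fun τ _ => (hp τ i).const_mul _
  exact ((((measurable_const.add (h1.const_mul _)).add h5).add h2).add (h3.const_mul _))

lemma pastInfo_mono (s : ℕ) (p u : ℤ → Fin N → Ω → ℝ) : Monotone (pastInfo s p u) := by
  intro t t' h
  refine sup_le_sup le_rfl (biSup_mono fun r hr => ?_)
  exact ⟨hr.1, hr.2.trans (by omega)⟩

lemma measurable_pastInfo_outcome {p u : ℤ → Fin N → Ω → ℝ} {t r : ℤ} (hr : 1 - (s : ℤ) ≤ r)
    (hrt : r ≤ t - 1) (i : Fin N) : Measurable[pastInfo s p u t] (outcome p u r i) := by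
  refine Measurable.of_comap_le (le_trans ?_ le_sup_right)
  exact le_trans (le_iSup (fun i => MeasurableSpace.comap (outcome p u r i) ⊤) i)
    (le_iSup₂_of_le r ⟨hr, hrt⟩ le_rfl)

lemma measurable_pastInfo_init {p u : ℤ → Fin N → Ω → ℝ} {t r : ℤ} (hr : 1 - (s : ℤ) ≤ r)
    (hr0 : r ≤ 0) (i : Fin N) : Measurable[pastInfo s p u t] (p r i) := by
  refine Measurable.of_comap_le (le_trans ?_ le_sup_left)
  exact le_trans (le_iSup (fun i => MeasurableSpace.comap (p r i) inferInstance) i)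
    (le_iSup₂_of_le r ⟨hr, hr0⟩ le_rfl)

variable [MeasurableSpace Ω] {P : Measure Ω} {p u : ℤ → Fin N → Ω → ℝ}

lemma pastInfo_le (hp : ∀ t, 1 - (s : ℤ) ≤ t → ∀ i, Measurable (p t i))
    (hu : ∀ t, 1 - (s : ℤ) ≤ t → ∀ i, Measurable (u t i)) (t : ℤ) :
    pastInfo s p u t ≤ ‹MeasurableSpace Ω› := by
  refine sup_le (iSup₂_le fun r hr => iSup_le fun i => (hp r hr.1 i).comap_le)
    (iSup₂_le fun r hr => iSup_le fun i => ?_)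
  exact (measurable_outcome (hp r hr.1 i) (hu r hr.1 i)).comap_le

/-- The past contains only the initial probabilities and the outcomes; later probabilities are
recovered from these by unrolling the model equation. Bounding the time by `n` makes all `s` lags
available to the induction. -/
lemma IsGABPath.measurable_prob (hθ : θ.Regular C A M) (h : IsGABPath θ P p u) (n : ℕ) :
    ∀ t : ℤ, 1 - (s : ℤ) ≤ t → t ≤ n → ∀ i, Measurable[pastInfo s p u t] (p t i) := by
  induction n with
  | zero => exact fun t ht ht0 i => measurable_pastInfo_init ht (by simpa using ht0) i
  | succ n ih =>
    intro t ht htn i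
    rcases le_or_gt t 0 with h0 | h0
    · exact measurable_pastInfo_init ht h0 i
    have hev : p t i = fun ω => θ.update p u t i ω := funext fun ω => h.evolution t h0 i ω
    rw [hev]
    refine @GABCoeffs.Regular.measurable_update s k N θ C A M Ω (pastInfo s p u t) hθ p u t ?_ ?_
      (h.pathLags_nonneg h0) (h.scaled_mem_lagCube h0) i
    · intro τ j
      have h1 := ih (t - 1 - τ) (lag_ge h0 τ) (by push_cast at htn; omega) j
      exact h1.mono (pastInfo_mono s p u (by omega)) le_rfl
    · intro τ j
      exact measurable_pastInfo_outcome (lag_ge h0 τ) (by omega) j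

/-- `p_{i,r}` is known before time `t` if `r ≤ t` or `r ≤ 0`. -/
lemma IsGABPath.measurable_prob_of_le (hθ : θ.Regular C A M) (h : IsGABPath θ P p u) {r t : ℤ}
    (hr : 1 - (s : ℤ) ≤ r) (hrt : r ≤ t ∨ r ≤ 0) (i : Fin N) :
    Measurable[pastInfo s p u t] (p r i) := by
  rcases hrt with hrt | hrt
  · exact (h.measurable_prob hθ r.toNat r hr (Int.self_le_toNat r) i).mono
      (pastInfo_mono s p u hrt) le_rfl
  · exact measurable_pastInfo_init hr hrt i

end Measurability

/-! ### Error bounds for the largest probability and for the sum of the probabilities. -/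

section Bounds

variable {s k N : ℕ} {θ : GABCoeffs s k} {C A M : ℝ} {Ω : Type*} [MeasurableSpace Ω]
  {P : Measure Ω} {p u : ℤ → Fin N → Ω → ℝ}

/-- A continuous function which dominates the error terms. -/
noncomputable def GABCoeffs.envelope (θ : GABCoeffs s k) (v : LagSpace s) : ℝ :=
  1 + ‖v‖ + ‖v‖ ^ 2 + ‖θ.fγExt v‖

/-- The rate at which the individual probabilities vanish. -/
noncomputable def GABCoeffs.probRate (θ : GABCoeffs s k) (C A M : ℝ) (N : ℕ) : ℝ :=
  C / N + 1 / (N : ℝ) ^ θ.κ * (|A| * s) + M / N + 1 / N * (k * C)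

/-- The greatest of the success probabilities at time `t`. -/
noncomputable def maxProb (p : ℤ → Fin N → Ω → ℝ) (t : ℤ) (ω : Ω) : ℝ := ⨆ i, p t i ω

omit [MeasurableSpace Ω] in
lemma prob_le_maxProb (p : ℤ → Fin N → Ω → ℝ) (t : ℤ) (i : Fin N) (ω : Ω) :
    p t i ω ≤ maxProb p t ω :=
  le_ciSup (f := fun i => p t i ω) (Set.finite_range _).bddAbove i

lemma IsGABPath.maxProb_nonneg (h : IsGABPath θ P p u) {t : ℤ} (ht : 1 - (s : ℤ) ≤ t) (ω : Ω) :
    0 ≤ maxProb p t ω := Real.iSup_nonneg fun i => (h.prob_mem t ht i ω).1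

/-- Apart from the autoregressive term, every term of the equation for one unit carries a factor
vanishing with `N`; what multiplies it is dominated by the envelope of the lagged sums. -/
lemma IsGABPath.maxProb_le (hθ : θ.Regular C A M) (h : IsGABPath θ P p u) {t : ℤ} (ht : 0 < t)
    (ω : Ω) : maxProb p t ω ≤ ∑ τ : Fin s, |θ.β τ| * maxProb p (t - 1 - (τ : ℤ)) ω
      + θ.probRate C A M N * θ.envelope (pathLags s p u t ω) := by
  have hC := hθ.nonneg_C
  have hM := hθ.nonneg_M
  have hR : 0 ≤ ∑ τ : Fin s, |θ.β τ| * maxProb p (t - 1 - (τ : ℤ)) ω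
      + θ.probRate C A M N * θ.envelope (pathLags s p u t ω) := by
    refine add_nonneg (Finset.sum_nonneg fun τ _ => mul_nonneg (abs_nonneg _)
      (h.maxProb_nonneg (lag_ge ht τ) ω)) (mul_nonneg ?_ ?_)
    · unfold GABCoeffs.probRate; positivity
    · unfold GABCoeffs.envelope; positivity
  -- Nonnegativity of the bound covers `N = 0`, where the supremum over no units is 0.
  refine Real.iSup_le (fun i => ?_) hR
  rw [h.evolution t ht i ω, GABCoeffs.update_eq]
  set v := pathLags s p u t ω with hv
  have hN : (0 : ℝ) < N := by exact_mod_cast (Nat.zero_le _).trans_lt i.2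
  have hE1 : 1 ≤ θ.envelope v := by
    unfold GABCoeffs.envelope; nlinarith [norm_nonneg v, norm_nonneg (θ.fγExt v), sq_nonneg ‖v‖]
  have hEv : ‖v‖ ≤ θ.envelope v := by
    unfold GABCoeffs.envelope; nlinarith [norm_nonneg v, norm_nonneg (θ.fγExt v), sq_nonneg ‖v‖]
  have hEf : ‖θ.fγExt v‖ ≤ θ.envelope v := by
    unfold GABCoeffs.envelope; nlinarith [norm_nonneg v, norm_nonneg (θ.fγExt v), sq_nonneg ‖v‖]
  have h1 : θ.c i / N ≤ C / N * θ.envelope v :=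
    ((div_le_div_iff_of_pos_right hN).2 (hθ.c_mem i).2).trans
      (le_mul_of_one_le_right (by positivity) hE1)
  have h2 : 1 / (N : ℝ) ^ θ.κ * θ.fα i (fun τ => outcome p u (t - 1 - (τ : ℤ)) i ω) ≤
      1 / (N : ℝ) ^ θ.κ * (|A| * s) * θ.envelope v := by
    refine le_trans ?_ (le_mul_of_one_le_right (by positivity) hE1)
    refine mul_le_mul_of_nonneg_left ?_ (by positivity)
    refine (le_abs_self _).trans ((hθ.fα_le i _).trans ?_)
    refine mul_le_mul (le_abs_self A) ?_
      (Finset.sum_nonneg fun τ _ => (outcome_mem p u _ i ω).1) (abs_nonneg _)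
    refine (Finset.sum_le_card_nsmul _ _ 1 fun τ _ => (outcome_mem p u _ i ω).2).trans ?_
    simp
  have h3 : ∑ τ : Fin s, θ.β τ * p (t - 1 - (τ : ℤ)) i ω ≤
      ∑ τ : Fin s, |θ.β τ| * maxProb p (t - 1 - (τ : ℤ)) ω :=
    Finset.sum_le_sum fun τ _ => mul_le_mul (le_abs_self _) (prob_le_maxProb _ _ _ _)
      (h.prob_mem _ (lag_ge ht τ) i ω).1 (abs_nonneg _)
  have h4 : θ.fγi i ((1 / N : ℝ) • v) ≤ M / N * θ.envelope v := by
    refine (le_abs_self _).trans ((abs_le_of_norm_fderivWithin_le (hθ.fγi_smooth i) (hθ.fγi_grad i)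
      (hθ.fγi_zero i) (h.scaled_mem_lagCube ht ω)).trans ?_)
    rw [norm_smul, Real.norm_of_nonneg (by positivity), ← mul_assoc, mul_one_div]
    exact mul_le_mul_of_nonneg_left hEv (by positivity)
  have h5 : 1 / (N : ℝ) * (θ.γ i ⬝ᵥ θ.fγ v) ≤ 1 / N * (k * C) * θ.envelope v := by
    rw [mul_assoc]
    refine mul_le_mul_of_nonneg_left ?_ (by positivity)
    refine (le_abs_self _).trans ((abs_dotProduct_le _ _).trans ?_)
    rw [Fintype.card_fin, ← θ.fγExt_eq (h.pathLags_nonneg ht ω), mul_assoc]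
    refine mul_le_mul_of_nonneg_left ?_ (by positivity)
    exact mul_le_mul (hθ.norm_γ_le i) hEf (norm_nonneg _) hC
  unfold GABCoeffs.probRate
  linarith

/-- The right-hand side of the recursion for the limiting intensity. -/
noncomputable def GABCoeffs.intensity (θ : GABCoeffs s k) (cbar : ℝ) (γbar : Fin k → ℝ)
    (fbar : LagSpace s) (t : ℤ) (a b : ℤ → ℝ) : ℝ :=
  cbar + ∑ τ : Fin s, θ.β τ * b (t - 1 - (τ : ℤ)) + lagVector s a b t ⬝ᵥ fbar
    + γbar ⬝ᵥ θ.fγExt (lagVector s a b t)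

/-- The rate at which the sum of the probabilities approaches the limiting recursion. -/
noncomputable def GABCoeffs.sumRate (θ : GABCoeffs s k) (A M cbar : ℝ) (γbar : Fin k → ℝ)
    (fbar : LagSpace s) (N : ℕ) : ℝ :=
  |1 / (N : ℝ) * ∑ i ∈ Finset.range N, θ.c i - cbar| + 1 / (N : ℝ) ^ θ.κ * (|A| * s) + M / N
    + (s + s) * ‖(1 / (N : ℝ)) • ∑ i ∈ Finset.range N, gradAtZero (θ.fγi i) - fbar‖
    + k * ‖(1 / (N : ℝ)) • ∑ i ∈ Finset.range N, θ.γ i - γbar‖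

/-- The equation is summed over units and each average is compared with its limit. The
autoregressive part is exactly linear and cancels; each summand of `sumRate` pays for one remaining
difference. -/
lemma IsGABPath.abs_probSum_sub_le (hθ : θ.Regular C A M) (h : IsGABPath θ P p u) {t : ℤ}
    (ht : 0 < t) (hN : 0 < N) (cbar : ℝ) (γbar : Fin k → ℝ) (fbar : LagSpace s) (ω : Ω) :
    |probSum p t ω - θ.intensity cbar γbar fbar t (fun r => successCount p u r ω)
      (fun r => probSum p r ω)| ≤
      θ.sumRate A M cbar γbar fbar N * θ.envelope (pathLags s p u t ω) := by
  have hM := hθ.nonneg_M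
  have hN' : (0 : ℝ) < N := by exact_mod_cast hN
  have hlag : lagVector s (fun r => successCount p u r ω) (fun r => probSum p r ω) t =
    pathLags s p u t ω := rfl
  rw [GABCoeffs.intensity, hlag]
  set v := pathLags s p u t ω with hv
  have hE1 : 1 ≤ θ.envelope v := by
    unfold GABCoeffs.envelope; nlinarith [norm_nonneg v, norm_nonneg (θ.fγExt v), sq_nonneg ‖v‖]
  have hEv : ‖v‖ ≤ θ.envelope v := by
    unfold GABCoeffs.envelope; nlinarith [norm_nonneg v, norm_nonneg (θ.fγExt v), sq_nonneg ‖v‖]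
  have hEv2 : ‖v‖ ^ 2 ≤ θ.envelope v := by
    unfold GABCoeffs.envelope; nlinarith [norm_nonneg v, norm_nonneg (θ.fγExt v), sq_nonneg ‖v‖]
  have hEf : ‖θ.fγExt v‖ ≤ θ.envelope v := by
    unfold GABCoeffs.envelope; nlinarith [norm_nonneg v, norm_nonneg (θ.fγExt v), sq_nonneg ‖v‖]
  set cN := 1 / (N : ℝ) * ∑ i ∈ Finset.range N, θ.c i with hcN
  set fN := (1 / (N : ℝ)) • ∑ i ∈ Finset.range N, gradAtZero (θ.fγi i) with hfN
  set γN := (1 / (N : ℝ)) • ∑ i ∈ Finset.range N, θ.γ i with hγN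
  have h1 : ∑ i : Fin N, θ.c i / N = cN := by
    rw [hcN, Finset.sum_range, ← Finset.sum_div, one_div_mul_eq_div]
  have h3 : ∑ i : Fin N, ∑ τ : Fin s, θ.β τ * p (t - 1 - (τ : ℤ)) i ω =
      ∑ τ : Fin s, θ.β τ * probSum p (t - 1 - (τ : ℤ)) ω := by
    rw [Finset.sum_comm]; simp [probSum, Finset.mul_sum]
  have h5 : ∑ i : Fin N, 1 / (N : ℝ) * (θ.γ i ⬝ᵥ θ.fγ v) = γN ⬝ᵥ θ.fγExt v := by
    rw [hγN, Finset.sum_range, smul_dotProduct, sum_dotProduct, ← Finset.mul_sum, smul_eq_mul,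
      θ.fγExt_eq (h.pathLags_nonneg ht ω)]
  have h4 : ∑ i : Fin N, gradAtZero (θ.fγi i) ⬝ᵥ ((1 / N : ℝ) • v) = v ⬝ᵥ fN := by
    rw [hfN, Finset.sum_range, dotProduct_smul, dotProduct_comm v, sum_dotProduct, Finset.smul_sum]
    exact Finset.sum_congr rfl fun i _ => dotProduct_smul _ _ _
  have hsum : probSum p t ω =
      cN + ∑ i : Fin N, 1 / (N : ℝ) ^ θ.κ * θ.fα i (fun τ => outcome p u (t - 1 - (τ : ℤ)) i ω)
        + ∑ τ : Fin s, θ.β τ * probSum p (t - 1 - (τ : ℤ)) ω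
        + ∑ i : Fin N, θ.fγi i ((1 / N : ℝ) • v) + γN ⬝ᵥ θ.fγExt v := by
    rw [probSum, Finset.sum_congr rfl fun i _ => (h.evolution t ht i ω).trans
      (GABCoeffs.update_eq p u t i ω)]
    simp only [Finset.sum_add_distrib]
    rw [h1, h3, h5]
  have hdecomp : probSum p t ω - (cbar + ∑ τ : Fin s, θ.β τ * probSum p (t - 1 - (τ : ℤ)) ω
        + v ⬝ᵥ fbar + γbar ⬝ᵥ θ.fγExt v) =
      (cN - cbar)
        + ∑ i : Fin N, 1 / (N : ℝ) ^ θ.κ * θ.fα i (fun τ => outcome p u (t - 1 - (τ : ℤ)) i ω)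
        + ∑ i : Fin N, (θ.fγi i ((1 / N : ℝ) • v) - gradAtZero (θ.fγi i) ⬝ᵥ ((1 / N : ℝ) • v))
        + (fN - fbar) ⬝ᵥ v + (γN - γbar) ⬝ᵥ θ.fγExt v := by
    rw [hsum, Finset.sum_sub_distrib, h4, sub_dotProduct, sub_dotProduct, dotProduct_comm v fN,
      dotProduct_comm v fbar]
    ring
  rw [hdecomp]
  have b1 : |cN - cbar| ≤ |cN - cbar| * θ.envelope v := le_mul_of_one_le_right (abs_nonneg _) hE1
  -- The bound on `fα` is linear in the unit's own outcomes, so summing over units yields lagged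
  -- success counts instead of a factor `N`.
  have b2 : |∑ i : Fin N, 1 / (N : ℝ) ^ θ.κ *
      θ.fα i (fun τ => outcome p u (t - 1 - (τ : ℤ)) i ω)| ≤
      1 / (N : ℝ) ^ θ.κ * (|A| * s) * θ.envelope v := by
    rw [← Finset.mul_sum, abs_mul, abs_of_nonneg (by positivity), mul_assoc]
    refine mul_le_mul_of_nonneg_left ?_ (by positivity)
    calc |∑ i : Fin N, θ.fα i (fun τ => outcome p u (t - 1 - (τ : ℤ)) i ω)|
        ≤ ∑ i : Fin N, |A| * ∑ τ : Fin s, ((outcome p u (t - 1 - (τ : ℤ)) i ω : ℕ) : ℝ) := by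
          refine (Finset.abs_sum_le_sum_abs _ _).trans (Finset.sum_le_sum fun i _ =>
            (hθ.fα_le i _).trans (mul_le_mul_of_nonneg_right (le_abs_self A)
              (Finset.sum_nonneg fun τ _ => (outcome_mem p u _ i ω).1)))
      _ = |A| * ∑ τ : Fin s, v (Sum.inl τ) := by
          rw [← Finset.mul_sum, Finset.sum_comm]; rfl
      _ ≤ |A| * (s * ‖v‖) := by
          refine mul_le_mul_of_nonneg_left ?_ (abs_nonneg _)
          refine (Finset.sum_le_card_nsmul _ _ ‖v‖ fun τ _ =>
            (le_abs_self _).trans (norm_le_pi_norm v _)).trans ?_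
          simp
      _ ≤ |A| * s * θ.envelope v := by
          rw [mul_assoc]; gcongr
  -- There are `N` Taylor remainders, each at most `M ‖v‖² / N²`.
  have b3 : |∑ i : Fin N, (θ.fγi i ((1 / N : ℝ) • v)
      - gradAtZero (θ.fγi i) ⬝ᵥ ((1 / N : ℝ) • v))| ≤ M / N * θ.envelope v := by
    calc _ ≤ ∑ i : Fin N, M * ‖(1 / N : ℝ) • v‖ ^ 2 :=
          (Finset.abs_sum_le_sum_abs _ _).trans (Finset.sum_le_sum fun i _ =>
            abs_sub_gradAtZero_dotProduct_le (hθ.fγi_smooth i) (hθ.fγi_hess i) (hθ.fγi_zero i)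
              (h.scaled_mem_lagCube ht ω))
      _ = M / N * ‖v‖ ^ 2 := by
          rw [norm_smul, Real.norm_of_nonneg (by positivity), Finset.sum_const, Finset.card_univ,
            Fintype.card_fin, nsmul_eq_mul]
          field_simp
      _ ≤ _ := by gcongr
  have b4 : |(fN - fbar) ⬝ᵥ v| ≤ (s + s) * ‖fN - fbar‖ * θ.envelope v := by
    refine (abs_dotProduct_le _ _).trans ?_
    rw [Fintype.card_sum, Fintype.card_fin, Nat.cast_add, mul_assoc]
    gcongr
  have b5 : |(γN - γbar) ⬝ᵥ θ.fγExt v| ≤ k * ‖γN - γbar‖ * θ.envelope v := by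
    refine (abs_dotProduct_le _ _).trans ?_
    rw [Fintype.card_fin, mul_assoc]
    gcongr
  refine (abs_add_le _ _).trans ((add_le_add ((abs_add_le _ _).trans (add_le_add
    ((abs_add_le _ _).trans (add_le_add ((abs_add_le _ _).trans (add_le_add b1 b2)) b3)) b4))
    b5).trans (le_of_eq ?_))
  unfold GABCoeffs.sumRate
  ring

lemma tendsto_one_div_rpow {κ : ℝ} (hκ : 0 < κ) :
    Tendsto (fun N : ℕ => 1 / (N : ℝ) ^ κ) atTop (𝓝 0) := by
  simp only [one_div]
  exact ((tendsto_rpow_atTop hκ).comp tendsto_natCast_atTop_atTop).inv_tendsto_atTop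

lemma GABCoeffs.tendsto_probRate (hκ : 0 < θ.κ) :
    Tendsto (θ.probRate C A M) atTop (𝓝 0) := by
  have h1 := tendsto_one_div_atTop_nhds_zero_nat (𝕜 := ℝ)
  have := (((tendsto_const_div_atTop_nhds_zero_nat C).add
    ((tendsto_one_div_rpow hκ).mul_const (|A| * s))).add
    (tendsto_const_div_atTop_nhds_zero_nat M)).add (h1.mul_const (k * C))
  rw [show 0 + 0 * (|A| * s) + 0 + 0 * (k * C) = (0 : ℝ) by ring] at this
  exact this

lemma GABCoeffs.tendsto_sumRate (hκ : 0 < θ.κ) {cbar : ℝ} {γbar : Fin k → ℝ} {fbar : LagSpace s}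
    (hcbar : Tendsto (fun N : ℕ => 1 / (N : ℝ) * ∑ i ∈ Finset.range N, θ.c i) atTop (𝓝 cbar))
    (hγbar : Tendsto (fun N : ℕ => (1 / (N : ℝ)) • ∑ i ∈ Finset.range N, θ.γ i) atTop (𝓝 γbar))
    (hfbar : Tendsto (fun N : ℕ => (1 / (N : ℝ)) • ∑ i ∈ Finset.range N, gradAtZero (θ.fγi i))
      atTop (𝓝 fbar)) :
    Tendsto (θ.sumRate A M cbar γbar fbar) atTop (𝓝 0) := by
  have := ((((hcbar.sub_const cbar).abs.add ((tendsto_one_div_rpow hκ).mul_const (|A| * s))).add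
    (tendsto_const_div_atTop_nhds_zero_nat M)).add
    ((hfbar.sub_const fbar).norm.const_mul (s + s : ℝ))).add
    ((hγbar.sub_const γbar).norm.const_mul (k : ℝ))
  simp only [sub_self, abs_zero, norm_zero, zero_mul, mul_zero, add_zero] at this
  exact this

lemma GABCoeffs.Regular.continuous_envelope (hθ : θ.Regular C A M) : Continuous θ.envelope := by
  have := hθ.continuous_fγExt
  unfold GABCoeffs.envelope
  fun_prop

lemma GABCoeffs.envelope_nonneg (v : LagSpace s) : 0 ≤ θ.envelope v := by
  unfold GABCoeffs.envelope; positivity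

end Bounds

/-! ### Poisson variables driven by independent uniform noise. -/

section Poisson

lemma measurable_poissonMeasure : Measurable poissonMeasure := by
  refine Measure.measurable_of_measurable_coe _ fun S hS => ?_
  have : ∀ r : NNReal, poissonMeasure r S = ∑' n, ENNReal.ofReal (Real.exp (-r) * r ^ n / n.factorial)
      * Measure.dirac n S := fun r => by
    rw [poissonMeasure, Measure.sum_apply _ hS]; rfl
  simp_rw [this]
  fun_prop

/-- The Poisson distribution can be simulated by a uniform variable, measurably in the intensity. -/
lemma exists_poisson_simulation : ∃ q : NNReal → unitInterval → ℕ,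
    Measurable (Function.uncurry q) ∧ ∀ r, volume.map (q r) = poissonMeasure r := by
  let κ : Kernel NNReal ℕ := ⟨poissonMeasure, measurable_poissonMeasure⟩
  have : IsMarkovKernel κ := ⟨fun r => inferInstanceAs (IsProbabilityMeasure (poissonMeasure r))⟩
  exact κ.exists_measurable_map_eq_unitInterval

variable {Ω : Type*} {m mΩ : MeasurableSpace Ω} {P : Measure Ω} [IsProbabilityMeasure P]
  {q : NNReal → unitInterval → ℕ} {lam : Ω → ℝ} {U : Ω → unitInterval}

/-- With the intensity frozen, the uniform variable simulates a Poisson law, whose characteristic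
function is explicit. The positive part is the real form of `toNNReal`. -/
lemma integral_mul_exp_poisson (hm : m ≤ mΩ) (hq : Measurable (Function.uncurry q))
    (hqlaw : ∀ r, volume.map (q r) = poissonMeasure r) (hlam : Measurable[m] lam)
    (hU : Measurable U) (hUlaw : P.map U = volume)
    (hind : Indep (MeasurableSpace.comap U inferInstance) m P)
    {V : Ω → ℂ} (hV : Measurable[m] V) (hV1 : ∀ ω, ‖V ω‖ ≤ 1) (b : ℝ) :
    ∫ ω, V ω * Complex.exp ((b * (q (lam ω).toNNReal (U ω) : ℝ) : ℝ) * Complex.I) ∂P =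
      ∫ ω, V ω * Complex.exp ((max (lam ω) 0 : ℝ) * (Complex.exp (b * Complex.I) - 1)) ∂P := by
  let clip : ℂ → ℂ := fun v => if ‖v‖ ≤ 1 then v else 0
  have hclip : Measurable clip := Measurable.ite (measurableSet_le (by fun_prop) (by fun_prop))
    measurable_id measurable_const
  have hclip1 : ∀ v, ‖clip v‖ ≤ 1 := fun v => by
    by_cases h : ‖v‖ ≤ 1 <;> simp [clip, h]
  have hclipV : ∀ ω, clip (V ω) = V ω := fun ω => by simp [clip, hV1 ω]
  have hcast : Measurable fun x : NNReal × unitInterval => (q x.1 x.2 : ℝ) :=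
    (Measurable.of_discrete (f := fun n : ℕ => (n : ℝ))).comp hq
  have key := integral_comp_of_indep (W := fun ω => (V ω, (lam ω).toNNReal)) (c := 1)
    (Ψ := fun x y => clip x.1 * Complex.exp ((b * (q x.2 y : ℝ) : ℝ) * Complex.I)) hm
    (hV.prodMk (measurable_real_toNNReal.comp hlam)) hU hind
    ((hclip.comp (by fun_prop)).mul (Complex.measurable_exp.comp
      ((Complex.measurable_ofReal.comp ((hcast.comp (f := fun z : (ℂ × NNReal) × unitInterval =>
        (z.1.2, z.2)) (by fun_prop)).const_mul b)).mul_const _)))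
    (fun x y => by
      rw [norm_mul, Complex.norm_exp_ofReal_mul_I, mul_one]; exact hclip1 _)
  simp only [hclipV, hUlaw] at key
  rw [key]
  refine integral_congr_ae (.of_forall fun ω => ?_)
  simp only
  rw [integral_const_mul]
  congr 1
  have h1 := charFun_map_cast_poissonMeasure (lam ω).toNNReal b
  have hqr : Measurable (q (lam ω).toNNReal) := hq.comp measurable_prodMk_left
  rw [← hqlaw, charFun_apply_real, integral_map .of_discrete (by fun_prop),
    integral_map hqr.aemeasurable .of_discrete] at h1
  rw [show (max (lam ω) 0 : ℝ) = ((lam ω).toNNReal : ℝ) from rfl]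
  simpa using h1

/-- Conditional expectation is tested on the sets of `m`; on each of them the freezing principle
replaces the indicator of the count by its Poisson probability. -/
lemma condExp_indicator_poisson (hm : m ≤ mΩ) (hq : Measurable (Function.uncurry q))
    (hqlaw : ∀ r, volume.map (q r) = poissonMeasure r) (hlam : Measurable[m] lam)
    (hU : Measurable U) (hUlaw : P.map U = volume)
    (hind : Indep (MeasurableSpace.comap U inferInstance) m P) (n : ℕ) :
    P[((fun ω => q (lam ω).toNNReal (U ω)) ⁻¹' {n}).indicator (fun _ => (1 : ℝ)) | m] =ᵐ[P]
      fun ω => (poissonMeasure (lam ω).toNNReal).real {n} := by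
  have hX : Measurable fun ω => q (lam ω).toNNReal (U ω) :=
    hq.comp ((measurable_real_toNNReal.comp (hlam.mono hm le_rfl)).prodMk hU)
  have hpm : Measurable[m] fun ω => (poissonMeasure (lam ω).toNNReal).real {n} := by
    have h1 : Measurable fun r : NNReal => (poissonMeasure r).real {n} :=
      ((Measure.measurable_coe (measurableSet_singleton n)).comp
        measurable_poissonMeasure).ennreal_toReal
    exact h1.comp (measurable_real_toNNReal.comp hlam)
  refine (ae_eq_condExp_of_forall_setIntegral_eq hm
    ((integrable_const _).indicator (hX (measurableSet_singleton n))) (fun S _ _ => ?_)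
    (fun S hS _ => ?_) hpm.stronglyMeasurable.aestronglyMeasurable).symm
  · exact (Integrable.of_bound (hpm.mono hm le_rfl).aestronglyMeasurable 1
      (.of_forall fun ω => by
        rw [Real.norm_of_nonneg measureReal_nonneg]; exact measureReal_le_one)).integrableOn
  have hW : Measurable[m] fun ω => (S.indicator (fun _ => (1 : ℝ)) ω, (lam ω).toNNReal) :=
    (Measurable.indicator (m := m) measurable_const hS).prodMk (measurable_real_toNNReal.comp hlam)
  -- The real coordinate carries the indicator of `S`, so `x.1 = 1` encodes membership in `S`.
  have hΨ : Measurable (Function.uncurry fun (x : ℝ × NNReal) (y : unitInterval) =>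
      if x.1 = 1 ∧ q x.2 y = n then (1 : ℝ) else 0) := by
    refine Measurable.ite (MeasurableSet.inter ?_ ?_) measurable_const measurable_const
    · exact measurableSet_eq_fun (by fun_prop) measurable_const
    · exact (hq.comp (f := fun z : (ℝ × NNReal) × unitInterval => (z.1.2, z.2)) (by fun_prop))
        (measurableSet_singleton n)
  have key := integral_comp_of_indep hm hW hU hind hΨ (c := 1) fun x y => by
    split_ifs <;> simp
  rw [hUlaw] at key
  have hS' := hm _ hS
  rw [← integral_indicator hS', ← integral_indicator hS']
  convert key.symm using 1
  · refine integral_congr_ae (.of_forall fun ω => ?_)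
    have hqr : Measurable (q (lam ω).toNNReal) := hq.comp measurable_prodMk_left
    by_cases hω : ω ∈ S
    · simp only [Set.indicator_of_mem hω, true_and]
      rw [← hqlaw, measureReal_def, Measure.map_apply hqr (measurableSet_singleton n),
        ← measureReal_def, ← integral_indicator_one (hqr (measurableSet_singleton n))]
      exact integral_congr_ae (.of_forall fun u => by simp [Set.indicator])
    · simp [Set.indicator_of_notMem hω]
  · refine integral_congr_ae (.of_forall fun ω => ?_)
    by_cases hω : ω ∈ S
    · simp [Set.indicator, hω]
    · simp [Set.indicator, hω]

end Poisson

/-! ### Explicit construction of the limiting process. -/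

section LimitPath

variable {s : ℕ}

/-- The limiting intensities and counts, numbered from the first time `1 - s`, as a function of the
initial intensities and the uniform variables that generate the counts. -/
noncomputable def limitPath (G : LagSpace s → ℝ) (q : NNReal → unitInterval → ℕ)
    (ω : ℕ → (Fin s → ℝ) × unitInterval) (j : ℕ) : ℝ × ℕ :=
  -- Entry `j` stands for time `1 - s + j`; the initial state is indexed by `τ` for time `-τ`,
  -- whence `s - 1 - j`. The count of entry `j` uses noise number `j + 1`, so its intensity depends
  -- on coordinates up to `j` only.
  let lam : ℝ := if h : j < s then (ω 0).1 ⟨s - 1 - j, by omega⟩ else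
    G (Sum.elim (fun τ => ((limitPath G q ω (j - 1 - τ)).2 : ℝ))
      (fun τ => (limitPath G q ω (j - 1 - τ)).1))
  (lam, q lam.toNNReal (ω (j + 1)).2)
termination_by j
decreasing_by all_goals (have := τ.2; omega)

/-- The limiting intensity at time `t`. -/
noncomputable def limitIntensity (G : LagSpace s → ℝ) (q : NNReal → unitInterval → ℕ) (t : ℤ)
    (ω : ℕ → (Fin s → ℝ) × unitInterval) : ℝ := (limitPath G q ω (t + s - 1).toNat).1

/-- The limiting count at time `t`. -/
noncomputable def limitCount (G : LagSpace s → ℝ) (q : NNReal → unitInterval → ℕ) (t : ℤ)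
    (ω : ℕ → (Fin s → ℝ) × unitInterval) : ℕ := (limitPath G q ω (t + s - 1).toNat).2

variable {G : LagSpace s → ℝ} {q : NNReal → unitInterval → ℕ}

lemma limitCount_eq (t : ℤ) (ω : ℕ → (Fin s → ℝ) × unitInterval) :
    limitCount G q t ω =
      q (limitIntensity G q t ω).toNNReal (ω ((t + s - 1).toNat + 1)).2 := by
  rw [limitCount, limitIntensity, limitPath]

lemma limitIntensity_init (τ : Fin s) (ω : ℕ → (Fin s → ℝ) × unitInterval) :
    limitIntensity G q (-(τ : ℤ)) ω = (ω 0).1 τ := by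
  have hτ := τ.2
  rw [limitIntensity, limitPath, dif_pos (by omega)]
  exact congrArg _ (Fin.ext (by simp only; omega))

lemma limitIntensity_of_pos {t : ℤ} (ht : 0 < t) (ω : ℕ → (Fin s → ℝ) × unitInterval) :
    limitIntensity G q t ω = G (lagVector s (fun r => (limitCount G q r ω : ℝ))
      (fun r => limitIntensity G q r ω) t) := by
  rw [limitIntensity, limitPath, dif_neg (by omega)]
  simp only
  congr 1
  have h : ∀ τ : Fin s, (t + s - 1).toNat - 1 - τ = (t - 1 - (τ : ℤ) + s - 1).toNat := fun τ => by
    have := τ.2; omega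
  funext j
  cases j with
  | inl τ => simp only [Sum.elim_inl, lagVector, limitCount, h]
  | inr τ => simp only [Sum.elim_inr, lagVector, limitIntensity, h]

/-- The `σ`-field generated by the first coordinates up to number `j`. -/
@[reducible] def coordInfo (s : ℕ) (j : ℕ) : MeasurableSpace (ℕ → (Fin s → ℝ) × unitInterval) :=
  ⨆ i ∈ Set.Iic j, MeasurableSpace.comap (fun ω => ω i) inferInstance

lemma coordInfo_mono (s : ℕ) : Monotone (coordInfo s) := fun _ _ h =>
  biSup_mono fun _ hi => le_trans hi h

lemma coordInfo_le (s j : ℕ) : coordInfo s j ≤ MeasurableSpace.pi :=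
  iSup₂_le fun i _ => (measurable_pi_apply i).comap_le

lemma measurable_coord {s i j : ℕ} (h : i ≤ j) :
    Measurable[coordInfo s j] fun ω : ℕ → (Fin s → ℝ) × unitInterval => ω i :=
  Measurable.of_comap_le (le_iSup₂_of_le i h le_rfl)

/-- The one-step gap between the two `σ`-fields is what leaves the noise of a count independent of
its intensity and of all earlier values. -/
lemma measurable_limitPath (hG : Measurable G) (hq : Measurable (Function.uncurry q)) (j : ℕ) :
    (Measurable[coordInfo s j] fun ω => (limitPath G q ω j).1) ∧
      Measurable[coordInfo s (j + 1)] fun ω => (limitPath G q ω j).2 := by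
  induction j using Nat.strong_induction_on with
  | _ j ih =>
    have h1 : Measurable[coordInfo s j] fun ω => (limitPath G q ω j).1 := by
      by_cases hj : j < s
      · have : (fun ω => (limitPath G q ω j).1) = fun ω : ℕ → (Fin s → ℝ) × unitInterval =>
            (ω 0).1 ⟨s - 1 - j, by omega⟩ := by
          funext ω; rw [limitPath, dif_pos hj]
        rw [this]
        exact (measurable_pi_apply _).comp (measurable_fst.comp (measurable_coord (Nat.zero_le j)))
      · have : (fun ω => (limitPath G q ω j).1) = fun ω =>
            G (Sum.elim (fun τ : Fin s => ((limitPath G q ω (j - 1 - τ)).2 : ℝ))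
              (fun τ : Fin s => (limitPath G q ω (j - 1 - τ)).1)) := by
          funext ω; rw [limitPath, dif_neg hj]
        rw [this]
        refine hG.comp (@measurable_pi_lambda _ _ _ (coordInfo s j) _ _ fun i => ?_)
        cases i with
        | inl τ =>
          have hτ := τ.2
          exact (Measurable.of_discrete (f := fun n : ℕ => (n : ℝ))).comp
            ((ih (j - 1 - τ) (by omega)).2.mono (coordInfo_mono s (by omega)) le_rfl)
        | inr τ =>
          have hτ := τ.2
          exact (ih (j - 1 - τ) (by omega)).1.mono (coordInfo_mono s (by omega)) le_rfl
    refine ⟨h1, ?_⟩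
    have : (fun ω => (limitPath G q ω j).2) = fun ω =>
        Function.uncurry q ((limitPath G q ω j).1.toNNReal, (ω (j + 1)).2) := by
      funext ω; rw [limitPath]; rfl
    rw [this]
    exact hq.comp ((measurable_real_toNNReal.comp
      (h1.mono (coordInfo_mono s (Nat.le_succ j)) le_rfl)).prodMk
      (measurable_snd.comp (measurable_coord le_rfl)))

lemma measurable_limitIntensity (hG : Measurable G) (hq : Measurable (Function.uncurry q)) (t : ℤ) :
    Measurable[coordInfo s (t + s - 1).toNat] (limitIntensity G q t) :=
  (measurable_limitPath hG hq _).1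

lemma measurable_limitCount (hG : Measurable G) (hq : Measurable (Function.uncurry q)) (t : ℤ) :
    Measurable[coordInfo s ((t + s - 1).toNat + 1)] (limitCount G q t) :=
  (measurable_limitPath hG hq _).2

/-- Counts up to `t - 1` use noise strictly before that of the count at `t`, so the latter noise is
independent of the conditioning `σ`-field. -/
lemma limitInfo_le_coordInfo (hG : Measurable G) (hq : Measurable (Function.uncurry q)) {t : ℤ}
    (ht : 1 - (s : ℤ) ≤ t) :
    limitInfo s (limitCount G q) (limitIntensity G q) (t - 1) ≤ coordInfo s (t + s - 1).toNat := by
  refine sup_le (iSup₂_le fun r hr => ?_) (iSup₂_le fun r hr => ?_)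
  · have h1 := hr.1
    have h2 := hr.2
    exact ((measurable_limitCount hG hq r).mono (coordInfo_mono s (by omega)) le_rfl).comap_le
  · have h1 := hr.1
    have h2 := hr.2
    obtain ⟨τ, rfl⟩ : ∃ τ : Fin s, r = -(τ : ℤ) :=
      ⟨⟨(-r).toNat, by omega⟩, by simp only; omega⟩
    have : limitIntensity G q (-(τ : ℤ)) = fun ω => (ω 0).1 τ := funext (limitIntensity_init τ)
    rw [this]
    refine Measurable.comap_le ?_
    exact (measurable_pi_apply τ).comp (measurable_fst.comp (measurable_coord (Nat.zero_le _)))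

lemma limitInfo_mono {Ω' : Type*} (s : ℕ) (X : ℤ → Ω' → ℕ) (lam : ℤ → Ω' → ℝ) :
    Monotone (limitInfo s X lam) := fun _ _ h =>
  sup_le_sup (biSup_mono fun _ hr => ⟨hr.1, hr.2.trans h⟩) le_rfl

/-- Only the initial intensities generate the `σ`-field; later ones are recovered from them and the
counts by unrolling the recursion. -/
lemma measurable_limitInfo_limitIntensity (hG : Measurable G) (n : ℕ) :
    ∀ t : ℤ, 1 - (s : ℤ) ≤ t → t ≤ n →
      Measurable[limitInfo s (limitCount G q) (limitIntensity G q) (t - 1)]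
        (limitIntensity G q t) := by
  have hinit : ∀ t : ℤ, 1 - (s : ℤ) ≤ t → t ≤ 0 →
      Measurable[limitInfo s (limitCount G q) (limitIntensity G q) (t - 1)]
        (limitIntensity G q t) := fun t ht ht0 =>
    Measurable.of_comap_le (le_trans (le_iSup₂_of_le (f := fun (r : ℤ)
      (_ : r ∈ Set.Icc (1 - (s : ℤ)) 0) => MeasurableSpace.comap (limitIntensity G q r) inferInstance)
      t ⟨ht, ht0⟩ le_rfl) le_sup_right)
  induction n with
  | zero => exact fun t ht ht0 => hinit t ht (by simpa using ht0)
  | succ n ih =>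
    intro t ht htn
    rcases le_or_gt t 0 with h0 | h0
    · exact hinit t ht h0
    have : limitIntensity G q t = fun ω => G (lagVector s (fun r => (limitCount G q r ω : ℝ))
      (fun r => limitIntensity G q r ω) t) := funext (limitIntensity_of_pos h0)
    rw [this]
    refine hG.comp (@measurable_pi_lambda _ _ _ (limitInfo s (limitCount G q)
      (limitIntensity G q) (t - 1)) _ _ fun i => ?_)
    cases i with
    | inl τ =>
      have h1 : Measurable[limitInfo s (limitCount G q) (limitIntensity G q) (t - 1)]
          (limitCount G q (t - 1 - (τ : ℤ))) :=
        Measurable.of_comap_le (le_trans (le_iSup₂_of_le (f := fun (r : ℤ)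
          (_ : r ∈ Set.Icc (1 - (s : ℤ)) (t - 1)) => MeasurableSpace.comap (limitCount G q r) ⊤)
          (t - 1 - (τ : ℤ)) ⟨lag_ge h0 τ, by omega⟩ le_rfl) le_sup_left)
      exact (Measurable.of_discrete (f := fun n : ℕ => (n : ℝ))).comp h1
    | inr τ =>
      exact (ih (t - 1 - τ) (lag_ge h0 τ) (by push_cast at htn; omega)).mono
        (limitInfo_mono _ _ _ (by omega)) le_rfl

variable (μ₀ : Measure (Fin s → ℝ)) [IsProbabilityMeasure μ₀]

/-- The law of independent copies of a pair of an initial state and a uniform variable. -/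
noncomputable def limitLaw : Measure (ℕ → (Fin s → ℝ) × unitInterval) :=
  Measure.infinitePi fun _ => μ₀.prod volume

instance : IsProbabilityMeasure (limitLaw μ₀) :=
  inferInstanceAs (IsProbabilityMeasure (Measure.infinitePi fun _ : ℕ => μ₀.prod volume))

lemma map_limitLaw_init : (limitLaw μ₀).map (fun ω => (ω 0).1) = μ₀ := by
  have h1 : (fun ω : ℕ → (Fin s → ℝ) × unitInterval => (ω 0).1) = Prod.fst ∘ fun ω => ω 0 := rfl
  rw [h1, ← Measure.map_map measurable_fst (measurable_pi_apply 0), limitLaw,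
    Measure.infinitePi_map_eval, Measure.map_fst_prod]
  simp

lemma map_limitLaw_noise (j : ℕ) : (limitLaw μ₀).map (fun ω => (ω j).2) = volume := by
  have h1 : (fun ω : ℕ → (Fin s → ℝ) × unitInterval => (ω j).2) = Prod.snd ∘ fun ω => ω j := rfl
  rw [h1, ← Measure.map_map measurable_snd (measurable_pi_apply j), limitLaw,
    Measure.infinitePi_map_eval, Measure.map_snd_prod]
  simp

/-- Coordinates of a product measure over disjoint index sets are independent. -/
lemma indep_noise_coordInfo (j : ℕ) :
    Indep (MeasurableSpace.comap (fun ω : ℕ → (Fin s → ℝ) × unitInterval => (ω (j + 1)).2)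
      inferInstance) (coordInfo s j) (limitLaw μ₀) := by
  have h1 : iIndepFun (fun i (ω : ℕ → (Fin s → ℝ) × unitInterval) => ω i) (limitLaw μ₀) :=
    iIndepFun_infinitePi (X := fun _ x => x) (fun _ => measurable_id)
  have h2 := indep_iSup_of_disjoint (fun i => (measurable_pi_apply i).comap_le)
    ((iIndepFun_iff_iIndep _ _ _).1 h1) (S := {j + 1}) (T := Set.Iic j) (by simp)
  refine indep_of_indep_of_le_left h2 ?_
  rw [iSup_singleton]
  exact (measurable_snd.comp (comap_measurable _)).comap_le

end LimitPath

/-! ### Characteristic function of the success count given the past. -/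

section Poissonization

variable {s k N : ℕ} {θ : GABCoeffs s k} {C A M : ℝ} {Ω : Type*} [MeasurableSpace Ω]
  {P : Measure Ω} [IsProbabilityMeasure P] {p u : ℤ → Fin N → Ω → ℝ}

omit [MeasurableSpace Ω] in
lemma exp_successCount (p u : ℤ → Fin N → Ω → ℝ) (t : ℤ) (b : ℝ) (ω : Ω) :
    Complex.exp ((b * successCount p u t ω : ℝ) * Complex.I) =
      ∏ i, (if u t i ω ≤ p t i ω then Complex.exp (b * Complex.I) else 1) := by
  rw [successCount, Finset.mul_sum, Complex.ofReal_sum, Finset.sum_mul, Complex.exp_sum]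
  refine Finset.prod_congr rfl fun i _ => ?_
  unfold outcome
  split_ifs <;> simp

lemma IsGABPath.integral_mul_exp_successCount (hθ : θ.Regular C A M) (h : IsGABPath θ P p u)
    (hp : ∀ t, 1 - (s : ℤ) ≤ t → ∀ i, Measurable (p t i))
    (hu : ∀ t, 1 - (s : ℤ) ≤ t → ∀ i, Measurable (u t i)) {t : ℤ} (ht : 1 - (s : ℤ) ≤ t)
    {V : Ω → ℂ} (hV : Measurable[pastInfo s p u t] V) (hV1 : ∀ ω, ‖V ω‖ ≤ 1) (b : ℝ) :
    ∫ ω, V ω * Complex.exp ((b * successCount p u t ω : ℝ) * Complex.I) ∂P =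
      ∫ ω, V ω * ∏ i, (1 + p t i ω * (Complex.exp (b * Complex.I) - 1)) ∂P := by
  simp only [exp_successCount]
  exact integral_mul_prod_ite_le (pastInfo_le hp hu t) hV hV1
    (fun i => h.measurable_prob_of_le hθ ht (.inl le_rfl) i) (fun i ω => h.prob_mem t ht i ω)
    (hu t ht) (h.error_law t ht) (h.error_iIndep t ht) (h.error_indep_past t ht)
    (Complex.norm_exp_ofReal_mul_I b).le

end Poissonization

/-! ### Indexing of counts and sums in order of revelation. -/

/-- Success counts (left coordinates) and sums of probabilities (right coordinates). -/
noncomputable def pathCoords {N : ℕ} {Ω : Type*} (p u : ℤ → Fin N → Ω → ℝ) (ω : Ω) : ℤ ⊕ ℤ → ℝ :=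
  Sum.elim (fun t => successCount p u t ω) (fun t => probSum p t ω)

/-- Limiting counts (left coordinates) and limiting intensities (right coordinates). -/
noncomputable def limitCoords {s : ℕ} (G : LagSpace s → ℝ) (q : NNReal → unitInterval → ℕ)
    (ω : ℕ → (Fin s → ℝ) × unitInterval) : ℤ ⊕ ℤ → ℝ :=
  Sum.elim (fun t => (limitCount G q t ω : ℝ)) (fun t => limitIntensity G q t ω)

/-- The initial sums of probabilities, and both coordinates at the first `n` times. -/
def coordSet (s : ℕ) : ℕ → Finset (ℤ ⊕ ℤ)
  | 0 => Finset.univ.image fun τ : Fin s => Sum.inr (-(τ : ℤ))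
  | n + 1 => insert (Sum.inl (1 - (s : ℤ) + n)) (insert (Sum.inr (1 - (s : ℤ) + n)) (coordSet s n))

lemma inl_mem_coordSet {s n : ℕ} {r : ℤ} :
    Sum.inl r ∈ coordSet s n ↔ 1 - (s : ℤ) ≤ r ∧ r < 1 - (s : ℤ) + n := by
  induction n with
  | zero => simp [coordSet]
  | succ n ih => simp [coordSet, ih]; omega

lemma inr_mem_coordSet {s n : ℕ} {r : ℤ} :
    Sum.inr r ∈ coordSet s n ↔ 1 - (s : ℤ) ≤ r ∧ (r ≤ 0 ∨ r < 1 - (s : ℤ) + n) := by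
  induction n with
  | zero =>
    simp only [coordSet, Finset.mem_image, Finset.mem_univ, true_and, Sum.inr.injEq]
    constructor
    · rintro ⟨τ, rfl⟩
      have := τ.2
      omega
    · intro h
      exact ⟨⟨(-r).toNat, by omega⟩, by simp only; omega⟩
  | succ n ih => simp [coordSet, ih]; omega

lemma lagVector_mem_congr {s n : ℕ} {t : ℤ} (h0 : 0 < t) (ht : t = 1 - (s : ℤ) + n)
    {x y : ℤ ⊕ ℤ → ℝ} (hxy : ∀ i ∈ (coordSet s n : Set (ℤ ⊕ ℤ)), x i = y i) :
    lagVector s (fun r => x (.inl r)) (fun r => x (.inr r)) t =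
      lagVector s (fun r => y (.inl r)) (fun r => y (.inr r)) t := by
  funext j
  cases j with
  | inl τ => exact hxy _ (inl_mem_coordSet.2 ⟨lag_ge h0 τ, by omega⟩)
  | inr τ => exact hxy _ (inr_mem_coordSet.2 ⟨lag_ge h0 τ, by omega⟩)

lemma continuous_lagVector (s : ℕ) (t : ℤ) : Continuous fun y : ℤ ⊕ ℤ → ℝ =>
    lagVector s (fun r => y (.inl r)) (fun r => y (.inr r)) t := by
  refine continuous_pi fun j => ?_
  cases j <;> exact continuous_apply _

section Measurability

variable {s : ℕ}

lemma measurable_pathCoords {N n : ℕ} {Ω : Type*} [MeasurableSpace Ω] {p u : ℤ → Fin N → Ω → ℝ}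
    (hp : ∀ t, 1 - (s : ℤ) ≤ t → ∀ i, Measurable (p t i))
    (hu : ∀ t, 1 - (s : ℤ) ≤ t → ∀ i, Measurable (u t i)) {j : ℤ ⊕ ℤ} (hj : j ∈ coordSet s n) :
    Measurable fun ω => pathCoords p u ω j := by
  cases j with
  | inl r =>
    have hr := (inl_mem_coordSet.1 hj).1
    exact measurable_successCount fun i => measurable_outcome (hp r hr i) (hu r hr i)
  | inr r => exact measurable_probSum (hp r (inr_mem_coordSet.1 hj).1)

lemma measurable_limitCoords {G : LagSpace s → ℝ} {q : NNReal → unitInterval → ℕ}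
    (hG : Measurable G) (hq : Measurable (Function.uncurry q)) (j : ℤ ⊕ ℤ) :
    Measurable fun ω => limitCoords G q ω j := by
  cases j with
  | inl r =>
    exact (Measurable.of_discrete (f := fun n : ℕ => (n : ℝ))).comp
      ((measurable_limitCount hG hq r).mono (coordInfo_le _ _) le_rfl)
  | inr r => exact (measurable_limitIntensity hG hq r).mono (coordInfo_le _ _) le_rfl

end Measurability

/-! ### Induction over time for joint convergence. -/

section Convergence

variable {s k : ℕ} {θ : GABCoeffs s k} {C A M : ℝ} {cbar : ℝ} {γbar : Fin k → ℝ}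
  {fbar : LagSpace s} {Ω : ℕ → Type*} [∀ N, MeasurableSpace (Ω N)] {P : ∀ N, Measure (Ω N)}
  [∀ N, IsProbabilityMeasure (P N)] {p u : ∀ N, ℤ → Fin N → Ω N → ℝ}
  {G : LagSpace s → ℝ} {q : NNReal → unitInterval → ℕ} {μ₀ : Measure (Fin s → ℝ)}
  [IsProbabilityMeasure μ₀]

/-- The recursion for the limiting intensity, as a function of the vector of lags. -/
noncomputable def GABCoeffs.lagIntensity (θ : GABCoeffs s k) (cbar : ℝ) (γbar : Fin k → ℝ)
    (fbar : LagSpace s) (v : LagSpace s) : ℝ :=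
  cbar + ∑ τ : Fin s, θ.β τ * v (.inr τ) + v ⬝ᵥ fbar + γbar ⬝ᵥ θ.fγExt v

lemma GABCoeffs.Regular.continuous_lagIntensity (hθ : θ.Regular C A M) (cbar : ℝ)
    (γbar : Fin k → ℝ) (fbar : LagSpace s) : Continuous (θ.lagIntensity cbar γbar fbar) := by
  have := hθ.continuous_fγExt
  unfold GABCoeffs.lagIntensity dotProduct
  fun_prop

/-- All lags of `t` are among the convergent coordinates, so a continuous function of them is tight.
-/
lemma bddInProb_envelope (hθ : θ.Regular C A M) {n : ℕ} {t : ℤ} (h0 : 0 < t)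
    (ht : t = 1 - (s : ℤ) + n)
    (h : TendstoOnCoords (coordSet s n) (fun N => pathCoords (p N) (u N)) (limitCoords G q) P
      (limitLaw μ₀)) :
    BddInProb P (fun N ω => θ.envelope (pathLags s (p N) (u N) t ω)) :=
  h.bddInProb (K := fun y => θ.envelope
    (lagVector s (fun r => y (.inl r)) (fun r => y (.inr r)) t))
    (hθ.continuous_envelope.comp (continuous_lagVector s t))
    (fun x y hxy => by simp only [lagVector_mem_congr h0 ht hxy])

/-- At a positive time the sum is the limiting recursion applied to its lags, up to a vanishing rate
times a tight envelope. -/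
lemma TendstoOnCoords.insert_probSum (hθ : θ.Regular C A M)
    (hsum : Tendsto (θ.sumRate A M cbar γbar fbar) atTop (𝓝 0))
    (hp : ∀ N t, 1 - (s : ℤ) ≤ t → ∀ i, Measurable (p N t i))
    (hu : ∀ N t, 1 - (s : ℤ) ≤ t → ∀ i, Measurable (u N t i))
    (hpath : ∀ᶠ N in atTop, IsGABPath θ (P N) (p N) (u N))
    (hq : Measurable (Function.uncurry q)) {n : ℕ}
    (h : TendstoOnCoords (coordSet s n) (fun N => pathCoords (p N) (u N))
      (limitCoords (θ.lagIntensity cbar γbar fbar) q) P (limitLaw μ₀)) :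
    TendstoOnCoords (insert (Sum.inr (1 - (s : ℤ) + n)) (coordSet s n))
      (fun N => pathCoords (p N) (u N)) (limitCoords (θ.lagIntensity cbar γbar fbar) q) P
      (limitLaw μ₀) := by
  obtain ⟨t, ht⟩ : ∃ t : ℤ, t = 1 - (s : ℤ) + n := ⟨_, rfl⟩
  rw [← ht]
  rcases le_or_gt t 0 with h0 | h0
  -- Sums at the initial dates belong to every `coordSet`, so there is nothing to add.
  · rwa [Finset.insert_eq_of_mem (inr_mem_coordSet.2 ⟨by omega, .inl h0⟩)]
  have hsub : insert (Sum.inr t) (coordSet s n) ⊆ coordSet s (n + 1) := by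
    rw [coordSet, ht]; exact Finset.subset_insert _ _
  have hG := hθ.continuous_lagIntensity cbar γbar fbar
  refine h.insert_of_negligible
    (F := fun y => θ.lagIntensity cbar γbar fbar
      (lagVector s (fun r => y (.inl r)) (fun r => y (.inr r)) t))
    (R := fun N ω => θ.sumRate A M cbar γbar fbar N * θ.envelope (pathLags s (p N) (u N) t ω))
    (fun N j hj => measurable_pathCoords (hp N) (hu N) (hsub hj))
    (fun j _ => measurable_limitCoords hG.measurable hq j)
    (hG.comp (continuous_lagVector s t))
    (fun x y hxy => by simp only [lagVector_mem_congr h0 ht hxy])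
    ((bddInProb_envelope hθ h0 ht h).mul_tendsto_zero
      (.of_forall fun N ω => θ.envelope_nonneg _) hsum) ?_ ?_
  · filter_upwards [hpath, eventually_gt_atTop 0] with N hN hN0 ω
    exact hN.abs_probSum_sub_le hθ h0 hN0 cbar γbar fbar ω
  · exact fun ω => limitIntensity_of_pos h0 ω

lemma measurable_maxProb {N : ℕ} {Ω : Type*} [MeasurableSpace Ω] {p : ℤ → Fin N → Ω → ℝ} {t : ℤ}
    (hp : ∀ i, Measurable (p t i)) : Measurable (maxProb p t) := Measurable.iSup hp

lemma negligible_maxProb (hθ : θ.Regular C A M) (hκ : 0 < θ.κ)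
    (hp : ∀ N t, 1 - (s : ℤ) ≤ t → ∀ i, Measurable (p N t i))
    (hpath : ∀ᶠ N in atTop, IsGABPath θ (P N) (p N) (u N)) {n : ℕ} {t : ℤ} (h0 : 0 < t)
    (ht : t = 1 - (s : ℤ) + n)
    (h : TendstoOnCoords (coordSet s n) (fun N => pathCoords (p N) (u N)) (limitCoords G q) P
      (limitLaw μ₀))
    (hmax : ∀ τ : Fin s, Negligible P fun N => maxProb (p N) (t - 1 - (τ : ℤ))) :
    Negligible P fun N => maxProb (p N) t := by
  have hm : ∀ (τ : Fin s) N, Measurable fun ω => |θ.β τ| * maxProb (p N) (t - 1 - (τ : ℤ)) ω :=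
    fun τ N => (measurable_maxProb (hp N _ (lag_ge h0 τ))).const_mul _
  have h1 := Negligible.sum Finset.univ (fun τ _ => (hmax τ).const_mul (abs_nonneg (θ.β τ)))
    (fun τ _ => .of_forall (hm τ))
  have h2 := (bddInProb_envelope hθ h0 ht h).mul_tendsto_zero
    (.of_forall fun N ω => θ.envelope_nonneg _) (θ.tendsto_probRate (C := C) (A := A) (M := M) hκ)
  refine (h1.add h2 (.of_forall fun N => Finset.measurable_sum _ fun τ _ => hm τ N)).mono ?_
  filter_upwards [hpath] with N hN ω
  exact hN.maxProb_le hθ h0 ω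

/-- The Poisson approximation costs at most `8 max p · ∑ p`, a negligible sequence times a tight
one. The sum at the same date must already be among the convergent coordinates, because it becomes
the intensity. -/
lemma TendstoOnCoords.insert_successCount (hθ : θ.Regular C A M)
    (hp : ∀ N t, 1 - (s : ℤ) ≤ t → ∀ i, Measurable (p N t i))
    (hu : ∀ N t, 1 - (s : ℤ) ≤ t → ∀ i, Measurable (u N t i))
    (hpath : ∀ᶠ N in atTop, IsGABPath θ (P N) (p N) (u N)) (hG : Measurable G)
    (hq : Measurable (Function.uncurry q)) (hqlaw : ∀ r, volume.map (q r) = poissonMeasure r)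
    {n : ℕ} (hmax : Negligible P fun N => maxProb (p N) (1 - (s : ℤ) + n))
    (h : TendstoOnCoords (insert (Sum.inr (1 - (s : ℤ) + n)) (coordSet s n))
      (fun N => pathCoords (p N) (u N)) (limitCoords G q) P (limitLaw μ₀)) :
    TendstoOnCoords (coordSet s (n + 1)) (fun N => pathCoords (p N) (u N)) (limitCoords G q) P
      (limitLaw μ₀) := by
  obtain ⟨t, ht⟩ : ∃ t : ℤ, t = 1 - (s : ℤ) + n := ⟨_, rfl⟩
  have ht' : 1 - (s : ℤ) ≤ t := by omega
  rw [coordSet]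
  rw [← ht] at h hmax ⊢
  have hsub : insert (Sum.inl t) (insert (Sum.inr t) (coordSet s n)) ⊆ coordSet s (n + 1) := by
    rw [coordSet, ht]
  set J := insert (Sum.inr t) (coordSet s n) with hJ
  have hlJ : Sum.inr t ∈ J := by simp [hJ]
  have hiJ : Sum.inl t ∉ J := by simp [hJ, inl_mem_coordSet, ht]
  have hJl : ∀ r, Sum.inl r ∈ J → 1 - (s : ℤ) ≤ r ∧ r ≤ t - 1 := fun r hr => by
    simp [hJ, inl_mem_coordSet] at hr; omega
  have hJr : ∀ r, Sum.inr r ∈ J → 1 - (s : ℤ) ≤ r ∧ (r ≤ t ∨ r ≤ 0) := fun r hr => by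
    simp [hJ, inr_mem_coordSet] at hr; omega
  have hYm : ∀ N, ∀ j ∈ insert (Sum.inl t) J, Measurable fun ω => pathCoords (p N) (u N) ω j :=
    fun N j hj => measurable_pathCoords (hp N) (hu N) (hsub hj)
  have hbdd : BddInProb P fun N ω => probSum (p N) t ω :=
    h.bddInProb (K := fun y => y (Sum.inr t)) (by fun_prop) (fun x y hxy => hxy _ hlJ)
  have hneg : Negligible P fun N ω => 8 * (maxProb (p N) t ω * probSum (p N) t ω) :=
    (hmax.mul_bddInProb hbdd (hpath.mono fun N hN => hN.maxProb_nonneg ht')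
      (.of_forall fun N => measurable_maxProb (hp N t ht'))).const_mul (by norm_num)
  refine h.insert_of_poisson hlJ hiJ hYm (fun j _ => measurable_limitCoords hG hq j)
    (hpath.mono fun N hN ω => (hN.probSum_mem ht' ω).1) (fun a b => ?_) (fun a b => ?_)
  · have hw : ‖Complex.exp (b * Complex.I)‖ ≤ 1 := (Complex.norm_exp_ofReal_mul_I b).le
    set w := Complex.exp (b * Complex.I) with hwdef
    have hVm : ∀ N, Measurable fun ω => Complex.exp
        ((∑ j ∈ J, a j * pathCoords (p N) (u N) ω j : ℝ) * Complex.I) := fun N =>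
      Complex.measurable_exp.comp ((Complex.measurable_ofReal.comp (Finset.measurable_sum _
        fun j hj => (hYm N j (by simp [hj])).const_mul _)).mul_const _)
    have hpm : ∀ N i, Measurable (p N t i) := fun N => hp N t ht'
    have hdiff : ∀ᶠ N in atTop, ∀ ω,
        ‖Complex.exp ((∑ j ∈ J, a j * pathCoords (p N) (u N) ω j : ℝ) * Complex.I) *
            ∏ i, (1 + p N t i ω * (w - 1)) -
          Complex.exp ((∑ j ∈ J, a j * pathCoords (p N) (u N) ω j : ℝ) * Complex.I) *
            Complex.exp (probSum (p N) t ω * (w - 1))‖ =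
        ‖∏ i, (1 + p N t i ω * (w - 1)) - Complex.exp (probSum (p N) t ω * (w - 1))‖ :=
      .of_forall fun N ω => by
        rw [← mul_sub, norm_mul, Complex.norm_exp_ofReal_mul_I, one_mul]
    have hprod : ∀ᶠ N in atTop, ∀ ω, ‖∏ i, (1 + (p N t i ω : ℂ) * (w - 1))‖ ≤ 1 := by
      filter_upwards [hpath] with N hN ω
      rw [norm_prod]
      exact Finset.prod_le_one (fun _ _ => norm_nonneg _) fun i _ =>
        norm_one_add_mul_sub_one_le (hN.prob_mem t ht' i ω) hw
    have hexp : ∀ᶠ N in atTop, ∀ ω, ‖Complex.exp ((probSum (p N) t ω : ℂ) * (w - 1))‖ ≤ 1 := by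
      filter_upwards [hpath] with N hN ω
      exact norm_exp_mul_sub_one_le_one (hN.probSum_mem ht' ω).1 hw
    have key := hneg.tendsto_integral_sub
      (A := fun N ω => Complex.exp ((∑ j ∈ J, a j * pathCoords (p N) (u N) ω j : ℝ) * Complex.I) *
            ∏ i, (1 + p N t i ω * (w - 1)))
      (B := fun N ω => Complex.exp ((∑ j ∈ J, a j * pathCoords (p N) (u N) ω j : ℝ) * Complex.I) *
            Complex.exp (probSum (p N) t ω * (w - 1))) ?_ ?_ ?_ ?_
    · refine key.congr' ?_
      filter_upwards [hpath] with N hN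
      -- Every coordinate in `J` is known before the errors at time `t`: counts up to `t - 1`, sums
      -- up to `t` or at initial dates.
      have hV : Measurable[pastInfo s (p N) (u N) t] fun ω => Complex.exp
          ((∑ j ∈ J, a j * pathCoords (p N) (u N) ω j : ℝ) * Complex.I) := by
        refine Complex.measurable_exp.comp ((Complex.measurable_ofReal.comp
          (Finset.measurable_sum (m := pastInfo s (p N) (u N) t) _
            fun j hj => Measurable.const_mul ?_ _)).mul_const _)
        cases j with
        | inl r =>
          exact @measurable_successCount _ _ (pastInfo s (p N) (u N) t) _ _ _ fun i =>
            measurable_pastInfo_outcome (hJl r hj).1 (hJl r hj).2 i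
        | inr r =>
          exact @measurable_probSum _ _ (pastInfo s (p N) (u N) t) _ _ fun i =>
            hN.measurable_prob_of_le hθ (hJr r hj).1 (hJr r hj).2 i
      have h1 := hN.integral_mul_exp_successCount hθ (hp N) (hu N) ht' hV
        (fun ω => (Complex.norm_exp_ofReal_mul_I _).le) b
      rw [← hwdef] at h1
      rw [← h1]
      rfl
    · filter_upwards [hprod] with N hN
      refine Integrable.of_bound ((hVm N).mul ?_).aestronglyMeasurable 1 (.of_forall fun ω => ?_)
      · fun_prop
      · rw [norm_mul, Complex.norm_exp_ofReal_mul_I, one_mul]; exact hN ω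
    · filter_upwards [hexp] with N hN
      have := measurable_probSum (hpm N)
      refine Integrable.of_bound ((hVm N).mul ?_).aestronglyMeasurable 1 (.of_forall fun ω => ?_)
      · fun_prop
      · rw [norm_mul, Complex.norm_exp_ofReal_mul_I, one_mul]; exact hN ω
    · filter_upwards [hpath, hdiff] with N hN hdiff ω
      rw [hdiff]
      refine (norm_prod_sub_exp_sum_le (fun i => hN.prob_mem t ht' i ω) hw).trans ?_
      refine mul_le_mul_of_nonneg_left ?_ (by norm_num)
      rw [probSum, Finset.mul_sum]
      refine Finset.sum_le_sum fun i _ => ?_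
      rw [sq]
      exact mul_le_mul_of_nonneg_right (prob_le_maxProb _ _ _ _) (hN.prob_mem t ht' i ω).1
    · filter_upwards [hdiff, hprod, hexp] with N hdiff h1 h2 ω
      rw [hdiff]
      exact (norm_sub_le _ _).trans (by linarith [h1 ω, h2 ω])
  -- Time `t` is entry `n` of the limit path: its noise is number `n + 1`, while the coordinates in
  -- `J` involve coordinates of the sample point up to `n` only.
  · have hn : (t + s - 1).toNat = n := by omega
    have hX : ∀ ω, limitCoords G q ω (Sum.inl t) =
        (q (limitIntensity G q t ω).toNNReal (ω (n + 1)).2 : ℝ) := fun ω => by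
      rw [limitCoords, Sum.elim_inl, limitCount_eq, hn]
    simp only [hX]
    refine integral_mul_exp_poisson (coordInfo_le s n) hq hqlaw
      (hn ▸ measurable_limitIntensity hG hq t) (by fun_prop) (map_limitLaw_noise μ₀ (n + 1))
      (indep_noise_coordInfo μ₀ n) ?_ (fun ω => (Complex.norm_exp_ofReal_mul_I _).le) b
    refine Complex.measurable_exp.comp ((Complex.measurable_ofReal.comp
      (Finset.measurable_sum (m := coordInfo s n) _
        fun j hj => Measurable.const_mul ?_ _)).mul_const _)
    cases j with
    | inl r =>
      have := hJl r hj
      exact (Measurable.of_discrete (f := fun n : ℕ => (n : ℝ))).comp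
        ((measurable_limitCount hG hq r).mono (coordInfo_mono s (by omega)) le_rfl)
    | inr r =>
      obtain ⟨hr1, hr2⟩ := hJr r hj
      rcases le_or_gt r 0 with h0 | h0
      · obtain ⟨τ, rfl⟩ : ∃ τ : Fin s, r = -(τ : ℤ) :=
          ⟨⟨(-r).toNat, by omega⟩, by simp only; omega⟩
        simp only [limitCoords, Sum.elim_inr, limitIntensity_init]
        exact (measurable_pi_apply τ).comp (measurable_fst.comp (measurable_coord (Nat.zero_le _)))
      · exact (measurable_limitIntensity hG hq r).mono (coordInfo_mono s (by omega)) le_rfl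

lemma tendstoOnCoords_coordSet (hθ : θ.Regular C A M) (hκ : 0 < θ.κ)
    (hsum : Tendsto (θ.sumRate A M cbar γbar fbar) atTop (𝓝 0))
    (hp : ∀ N t, 1 - (s : ℤ) ≤ t → ∀ i, Measurable (p N t i))
    (hu : ∀ N t, 1 - (s : ℤ) ≤ t → ∀ i, Measurable (u N t i))
    (hpath : ∀ᶠ N in atTop, IsGABPath θ (P N) (p N) (u N))
    (hq : Measurable (Function.uncurry q)) (hqlaw : ∀ r, volume.map (q r) = poissonMeasure r)
    (hmax : ∀ τ : Fin s, Negligible P fun N => maxProb (p N) (-(τ : ℤ)))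
    (hinit : TendstoOnCoords (coordSet s 0) (fun N => pathCoords (p N) (u N))
      (limitCoords (θ.lagIntensity cbar γbar fbar) q) P (limitLaw μ₀)) (n : ℕ) :
    TendstoOnCoords (coordSet s n) (fun N => pathCoords (p N) (u N))
      (limitCoords (θ.lagIntensity cbar γbar fbar) q) P (limitLaw μ₀) := by
  -- Smallness of the largest probability at all dates reached so far is carried along, since the
  -- next Poisson step needs it and it needs tightness of the lags in turn.
  suffices h : TendstoOnCoords (coordSet s n) (fun N => pathCoords (p N) (u N))
      (limitCoords (θ.lagIntensity cbar γbar fbar) q) P (limitLaw μ₀) ∧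
      ∀ t : ℤ, 1 - (s : ℤ) ≤ t → (t ≤ 0 ∨ t < 1 - (s : ℤ) + n) →
        Negligible P fun N => maxProb (p N) t from h.1
  have hG := hθ.continuous_lagIntensity cbar γbar fbar
  induction n with
  | zero =>
    refine ⟨hinit, fun t ht ht0 => ?_⟩
    obtain ⟨τ, rfl⟩ : ∃ τ : Fin s, t = -(τ : ℤ) := by
      have : t ≤ 0 := by rcases ht0 with h | h <;> [exact h; (push_cast at h; omega)]
      exact ⟨⟨(-t).toNat, by omega⟩, by simp only; omega⟩
    exact hmax τ
  | succ n ih =>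
    obtain ⟨ih1, ih2⟩ := ih
    have hm : Negligible P fun N => maxProb (p N) (1 - (s : ℤ) + n) := by
      rcases le_or_gt (1 - (s : ℤ) + n) 0 with h0 | h0
      · exact ih2 _ (by omega) (.inl h0)
      · exact negligible_maxProb hθ hκ hp hpath h0 rfl ih1 fun τ =>
          ih2 _ (lag_ge h0 τ) (.inr (by omega))
    refine ⟨(ih1.insert_probSum hθ hsum hp hu hpath hq).insert_successCount hθ hp hu hpath
      hG.measurable hq hqlaw hm, fun t ht ht0 => ?_⟩
    rcases eq_or_ne t (1 - (s : ℤ) + n) with rfl | hne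
    · exact hm
    · exact ih2 t ht (by push_cast at ht0; omega)

/-- The initial intensities under `limitLaw μ₀` have law `μ₀`, so this is the assumed initial
convergence, reindexed from `Fin s` to `coordSet s 0`. -/
lemma tendstoOnCoords_init {Ω₀ : Type*} [MeasurableSpace Ω₀] {P₀ : Measure Ω₀}
    [IsProbabilityMeasure P₀] {lam₀ : Fin s → Ω₀ → ℝ} (hG : Measurable G)
    (hq : Measurable (Function.uncurry q))
    (hp : ∀ N t, 1 - (s : ℤ) ≤ t → ∀ i, Measurable (p N t i))
    (hu : ∀ N t, 1 - (s : ℤ) ≤ t → ∀ i, Measurable (u N t i))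
    (h : TendstoInDistribution (fun N ω (τ : Fin s) => probSum (p N) (-(τ : ℤ)) ω) atTop
      (fun ω τ => lam₀ τ ω) P P₀) (hμ₀ : μ₀ = P₀.map fun ω τ => lam₀ τ ω) :
    TendstoOnCoords (coordSet s 0) (fun N => pathCoords (p N) (u N)) (limitCoords G q) P
      (limitLaw μ₀) := by
  refine tendstoOnCoords_of_charFun (fun N j hj => measurable_pathCoords (hp N) (hu N) hj)
    (fun j _ => measurable_limitCoords hG hq j) fun a => ?_
  have hinj : Function.Injective fun τ : Fin s => (Sum.inr (-(τ : ℤ)) : ℤ ⊕ ℤ) := fun τ τ' hτ => by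
    simp only [Sum.inr.injEq] at hτ
    ext; omega
  have hcont : Continuous fun v : Fin s → ℝ => Complex.exp
      ((∑ τ : Fin s, a (Sum.inr (-(τ : ℤ))) * v τ : ℝ) * Complex.I) := by fun_prop
  have h1 := (ProbabilityMeasure.tendsto_iff_forall_integral_rclike_tendsto ℂ).1 h.tendsto
    (BoundedContinuousFunction.ofNormedAddCommGroup _ hcont 1
      fun v => (Complex.norm_exp_ofReal_mul_I _).le)
  simp only [BoundedContinuousFunction.coe_ofNormedAddCommGroup, ProbabilityMeasure.coe_mk] at h1
  have h0 : Measurable fun ω : ℕ → (Fin s → ℝ) × unitInterval => (ω 0).1 :=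
    measurable_fst.comp (measurable_pi_apply 0)
  rw [← hμ₀, ← map_limitLaw_init μ₀, integral_map h0.aemeasurable hcont.aestronglyMeasurable] at h1
  simp_rw [fun N => integral_map (h.forall_aemeasurable N) hcont.aestronglyMeasurable] at h1
  simp only [coordSet, Finset.sum_image fun _ _ _ _ h => hinj h, limitCoords, pathCoords,
    Sum.elim_inr, limitIntensity_init]
  exact h1

end Convergence

/-! ### Properties of the limit and the main theorem. -/

section Limit

variable {s k : ℕ} {Ω : ℕ → Type*} [∀ N, MeasurableSpace (Ω N)] {P : ∀ N, Measure (Ω N)}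
  [∀ N, IsProbabilityMeasure (P N)] {p u : ∀ N, ℤ → Fin N → Ω N → ℝ}
  {G : LagSpace s → ℝ} {q : NNReal → unitInterval → ℕ} {μ₀ : Measure (Fin s → ℝ)}
  [IsProbabilityMeasure μ₀]

lemma exists_forall_lt_time (s : ℕ) (I : Finset ℤ) : ∃ n : ℕ, ∀ t ∈ I, t < 1 - (s : ℤ) + n := by
  refine ⟨I.sup fun t => (t + s).toNat, fun t ht => ?_⟩
  have := Finset.le_sup (f := fun t : ℤ => (t + s).toNat) ht
  omega

/-- Convergence of continuous functions of the pairs of coordinates at each time follows from the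
convergence of all coordinate sets. -/
lemma tendstoFDD_of_tendstoOnCoords {E : Type*} [TopologicalSpace E] [SecondCountableTopology E]
    [MeasurableSpace E] [BorelSpace E]
    (h : ∀ n, TendstoOnCoords (coordSet s n) (fun N => pathCoords (p N) (u N)) (limitCoords G q) P
      (limitLaw μ₀)) {g : ℝ × ℝ → E} (hg : Continuous g) :
    TendstoFDD (1 - (s : ℤ))
      (fun N t ω => g (successCount (p N) (u N) t ω, probSum (p N) t ω))
      (fun t ω => g ((limitCount G q t ω : ℝ), limitIntensity G q t ω)) P (limitLaw μ₀) := by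
  intro I hI
  obtain ⟨n, hn⟩ := exists_forall_lt_time s I
  refine (h n).continuous_comp (g := fun y (t : I) => g (y (Sum.inl t), y (Sum.inr t)))
    (continuous_pi fun t => hg.comp (by fun_prop)) fun x y hxy => ?_
  funext t
  have h1 := hI t t.2
  have h2 := hn t t.2
  simp only
  rw [hxy _ (inl_mem_coordSet.2 ⟨h1, h2⟩), hxy _ (inr_mem_coordSet.2 ⟨h1, .inr h2⟩)]

lemma ae_limitIntensity_nonneg {θ : GABCoeffs s k}
    (hpath : ∀ᶠ N in atTop, IsGABPath θ (P N) (p N) (u N))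
    (h : ∀ n, TendstoOnCoords (coordSet s n) (fun N => pathCoords (p N) (u N)) (limitCoords G q) P
      (limitLaw μ₀)) {t : ℤ} (ht : 1 - (s : ℤ) ≤ t) :
    ∀ᵐ ω ∂(limitLaw μ₀), 0 ≤ limitIntensity G q t ω :=
  (h (t + s).toNat).ae_nonneg (i := Sum.inr t) (inr_mem_coordSet.2 ⟨ht, .inr (by omega)⟩)
    (hpath.mono fun _ hN ω => (hN.probSum_mem ht ω).1)

/-- The intensity is measurable for `limitInfo`, and the noise of the count is independent of it
because it is independent of the larger `coordInfo`. -/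
lemma isCondPoisson_limit (hG : Measurable G) (hq : Measurable (Function.uncurry q))
    (hqlaw : ∀ r, volume.map (q r) = poissonMeasure r) {t : ℤ} (ht : 1 - (s : ℤ) ≤ t)
    (h0 : ∀ᵐ ω ∂(limitLaw μ₀), 0 ≤ limitIntensity G q t ω) :
    IsCondPoisson (limitLaw μ₀) (limitCount G q t) (limitIntensity G q t)
      (limitInfo s (limitCount G q) (limitIntensity G q) (t - 1)) := by
  refine ⟨h0, fun n => ?_⟩
  have hX : limitCount G q t = fun ω =>
    q (limitIntensity G q t ω).toNNReal (ω ((t + s - 1).toNat + 1)).2 := funext (limitCount_eq t)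
  have hle := limitInfo_le_coordInfo hG hq ht
  have key := condExp_indicator_poisson (hle.trans (coordInfo_le _ _)) hq hqlaw
    (measurable_limitInfo_limitIntensity hG t.toNat t ht (Int.self_le_toNat t))
    (U := fun ω => (ω ((t + s - 1).toNat + 1)).2) (by fun_prop) (map_limitLaw_noise μ₀ _)
    (indep_of_indep_of_le_right (indep_noise_coordInfo μ₀ _) hle) n
  rwa [← hX] at key

end Limit

theorem mainTheorem2 {s k : ℕ} (hs : 1 ≤ s) (θ : GABCoeffs s k)
    -- conditions on the coefficients
    (C : ℝ) (hκ : 0 < θ.κ)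
    (hc : ∀ i, 0 ≤ θ.c i ∧ θ.c i ≤ C)
    (hγ : ∀ i, 0 ≤ θ.γ i ∧ ‖θ.γ i‖ ≤ C)
    -- conditions on the functions
    (hfα_nonneg : ∀ i v, 0 ≤ θ.fα i v)
    (A : ℝ) (hfα : ∀ i v, |θ.fα i v| ≤ A * ∑ τ, ((v τ : ℕ) : ℝ))
    (hfγi_nonneg : ∀ i, ∀ x ∈ lagCube s, 0 ≤ θ.fγi i x)
    (hfγi_smooth : ∀ i, ContDiffOn ℝ 2 (θ.fγi i) (lagCube s))
    (M : ℝ) (hfγi_grad : ∀ i, ∀ x ∈ lagCube s, ‖fderivWithin ℝ (θ.fγi i) (lagCube s) x‖ ≤ M)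
    (hfγi_hess : ∀ i, ∀ x ∈ lagCube s,
      ‖iteratedFDerivWithin ℝ 2 (θ.fγi i) (lagCube s) x‖ ≤ M)
    (hfγi_zero : ∀ i, θ.fγi i 0 = 0)
    (hfγi_grad_zero : ∀ i, 0 ≤ gradAtZero (θ.fγi i))
    (hfγ_nonneg : ∀ x ∈ lagOrthant s, 0 ≤ θ.fγ x)
    (hfγ : (ContinuousOn θ.fγ (lagOrthant s) ∧ ∃ B : ℝ, ∀ x ∈ lagOrthant s, ‖θ.fγ x‖ ≤ B) ∨
      (ContDiffOn ℝ 1 θ.fγ (lagOrthant s) ∧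
        ∃ B : ℝ, ∀ x ∈ lagOrthant s, ‖fderivWithin ℝ θ.fγ (lagOrthant s) x‖ ≤ B))
    -- limits of the cross-sectional averages
    (cbar : ℝ) (γbar : Fin k → ℝ) (fbar : LagSpace s)
    (hcbar : Tendsto (fun N : ℕ => 1 / (N : ℝ) * ∑ i ∈ Finset.range N, θ.c i) atTop (𝓝 cbar))
    (hγbar : Tendsto (fun N : ℕ => (1 / (N : ℝ)) • ∑ i ∈ Finset.range N, θ.γ i) atTop (𝓝 γbar))
    (hfbar : Tendsto (fun N : ℕ => (1 / (N : ℝ)) • ∑ i ∈ Finset.range N, gradAtZero (θ.fγi i))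
      atTop (𝓝 fbar))
    -- for every large `N`, a path of the model with `N` units
    {Ω : ℕ → Type*} [∀ N, MeasurableSpace (Ω N)] (P : ∀ N, Measure (Ω N))
    [∀ N, IsProbabilityMeasure (P N)]
    (p u : ∀ N, ℤ → Fin N → Ω N → ℝ)
    (hp_meas : ∀ N t, 1 - (s : ℤ) ≤ t → ∀ i, Measurable (p N t i))
    (hu_meas : ∀ N t, 1 - (s : ℤ) ≤ t → ∀ i, Measurable (u N t i))
    (hpath : ∀ᶠ N in atTop, IsGABPath θ (P N) (p N) (u N))
    -- initial conditions; `lam₀ τ` is the limit at time `-τ`, for `τ = 0, …, s - 1`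
    {Ω₀ : Type*} [MeasurableSpace Ω₀] (P₀ : Measure Ω₀) [IsProbabilityMeasure P₀]
    (lam₀ : Fin s → Ω₀ → ℝ) (hlam₀ : ∀ τ, Integrable (lam₀ τ) P₀)
    (hinit_dist : TendstoInDistribution (fun N ω (τ : Fin s) => probSum (p N) (-(τ : ℤ)) ω) atTop
      (fun ω τ => lam₀ τ ω) P P₀)
    (hinit_mean : ∀ τ : Fin s, Tendsto (fun N => ∑ i, ∫ ω, p N (-(τ : ℤ)) i ω ∂(P N)) atTop
      (𝓝 (∫ ω, lam₀ τ ω ∂P₀)))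
    (hinit_max : ∀ τ : Fin s, ∀ ε : ℝ, 0 < ε →
      Tendsto (fun N => P N {ω | ε ≤ ⨆ i, p N (-(τ : ℤ)) i ω}) atTop (𝓝 0)) :
    ∃ (Ω' : Type) (_ : MeasurableSpace Ω') (Q : Measure Ω') (_ : IsProbabilityMeasure Q)
      (X : ℤ → Ω' → ℕ) (lam : ℤ → Ω' → ℝ),
      (∀ t, Measurable (X t)) ∧ (∀ t, Measurable (lam t)) ∧
      -- the initial intensities have the prescribed joint law
      IdentDistrib (fun ω (τ : Fin s) => lam (-(τ : ℤ)) ω) (fun ω τ => lam₀ τ ω) Q P₀ ∧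
      -- convergence of the number of successes
      TendstoFDD (1 - (s : ℤ)) (fun N => successCount (p N) (u N))
        (fun t ω => (X t ω : ℝ)) P Q ∧
      -- `X_t` is Poisson with intensity `λ_t` conditionally on the past
      (∀ t, 1 - (s : ℤ) ≤ t → IsCondPoisson Q (X t) (lam t) (limitInfo s X lam (t - 1))) ∧
      -- `λ_t` is the limit of the sum of the success probabilities, jointly with `X_t`
      TendstoFDD (1 - (s : ℤ))
        (fun N t ω => (successCount (p N) (u N) t ω, probSum (p N) t ω))
        (fun t ω => ((X t ω : ℝ), lam t ω)) P Q ∧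
      -- the recursion for the intensity
      ∀ t, 0 < t → ∀ᵐ ω ∂Q,
        lam t ω = cbar + ∑ τ : Fin s, θ.β τ * lam (t - 1 - (τ : ℤ)) ω
          + lagVector s (fun r => (X r ω : ℝ)) (fun r => lam r ω) t ⬝ᵥ fbar
          + γbar ⬝ᵥ θ.fγ (lagVector s (fun r => (X r ω : ℝ)) (fun r => lam r ω) t) := by
  have hθ : θ.Regular C A M := ⟨hc, fun i => (hγ i).2, hfα, hfγi_smooth, hfγi_grad,
    hfγi_hess, hfγi_zero, hfγ.elim (fun h => h.1) fun h => h.1.continuousOn⟩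
  have hG := hθ.continuous_lagIntensity cbar γbar fbar
  obtain ⟨q, hq, hqlaw⟩ := exists_poisson_simulation
  have hlam₀m := hinit_dist.aemeasurable_limit
  obtain ⟨μ₀, hμ₀⟩ : ∃ μ₀ : Measure (Fin s → ℝ), μ₀ = P₀.map fun ω τ => lam₀ τ ω := ⟨_, rfl⟩
  have : IsProbabilityMeasure μ₀ := hμ₀ ▸ Measure.isProbabilityMeasure_map hlam₀m
  have hmax : ∀ τ : Fin s, Negligible P fun N => maxProb (p N) (-(τ : ℤ)) := fun τ =>
    negligible_of_tendsto_measure (hinit_max τ) fun N => measurable_maxProb (hp_meas N _ (by omega))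
  have hconv := tendstoOnCoords_coordSet hθ hκ (θ.tendsto_sumRate hκ hcbar hγbar hfbar) hp_meas
    hu_meas hpath hq hqlaw hmax (tendstoOnCoords_init hG.measurable hq hp_meas hu_meas hinit_dist hμ₀)
  have hnonneg : ∀ t : ℤ, 1 - (s : ℤ) ≤ t → ∀ᵐ ω ∂(limitLaw μ₀),
      0 ≤ limitIntensity (θ.lagIntensity cbar γbar fbar) q t ω := fun t ht =>
    ae_limitIntensity_nonneg hpath hconv ht
  refine ⟨_, inferInstance, limitLaw μ₀, inferInstance, limitCount (θ.lagIntensity cbar γbar fbar) q,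
    limitIntensity (θ.lagIntensity cbar γbar fbar) q,
    fun t => (measurable_limitCount hG.measurable hq t).mono (coordInfo_le _ _) le_rfl,
    fun t => (measurable_limitIntensity hG.measurable hq t).mono (coordInfo_le _ _) le_rfl,
    ?_, tendstoFDD_of_tendstoOnCoords hconv continuous_fst,
    fun t ht => isCondPoisson_limit hG.measurable hq hqlaw ht (hnonneg t ht),
    tendstoFDD_of_tendstoOnCoords hconv continuous_id, fun t ht => ?_⟩
  · simp only [limitIntensity_init]
    refine ⟨(measurable_fst.comp (measurable_pi_apply 0)).aemeasurable, hlam₀m, ?_⟩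
    exact (map_limitLaw_init μ₀).trans hμ₀
  -- The construction uses `fγExt`; it agrees with `fγ` where all lagged intensities are
  -- nonnegative, which holds almost surely.
  · have h1 : ∀ᵐ ω ∂(limitLaw μ₀), ∀ τ : Fin s,
        0 ≤ limitIntensity (θ.lagIntensity cbar γbar fbar) q (t - 1 - (τ : ℤ)) ω :=
      ae_all_iff.2 fun τ => hnonneg _ (lag_ge ht τ)
    filter_upwards [h1] with ω hω
    rw [limitIntensity_of_pos ht, GABCoeffs.lagIntensity, θ.fγExt_eq]
    · rfl
    · intro j
      cases j with
      | inl τ => exact Nat.cast_nonneg _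
      | inr τ => exact hω τ
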